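/- Let $D=(0,1)$, let $\|\cdot\|_{0,D}$, $(\cdot,\cdot)_{0,D}$ be the norm and inner product of $L^2(D)$, and put $\lambda_i=i\pi$, $\varepsilon_i(x)=\sqrt2\sin(\lambda_i x)$ for $i\ge 1$. For $s\in\mathbb R$ and $v\in L^2(D)$ let $\|v\|_{\dot H^s}=\big(\sum_{i\ge1}\lambda_i^{2s}(v,\varepsilon_i)_{0,D}^2\big)^{1/2}$, and for $s\ge 0$ let $\dot H^s(D)$ be the set of $v\in L^2(D)$ for which this is finite. Fix $T>0$, $\mu\in\mathbb R$ and $r\in\{2,3\}$. Let $M\ge1$, $\Delta\tau=T/M$. For $w_0\in\dot H^1(D)$ let $W^0=w_0$ and let $W^1,\dots,W^M\in\dot H^4(D)$ satisfy $$W^1-W^0+\Delta\tau\,\partial_x^4W^1=0,\qquad W^m-W^{m-1}+\Delta\tau\,\big(\partial_x^4W^m+\mu\,\partial_x^2W^{m-1}\big)=0\quad(m=2,\dots,M).$$ Let $0=x_0<x_1<\dots<x_J=1$ be a partition of $D$ with maximum mesh length $h$, and let $\mathsf M_h^r\subset H^2(D)\cap H^1_0(D)$ be a finite element space of degree $r$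 over it, that is, a linear space of functions which are polynomials of degree at most $r$ on each interval of the partition, containing all such functions of maximal smoothness, i.e. those that lie in $H^r(D)\cap H_0^1(D)$. (For $r=2$ it is the space of all piecewise polynomials of degree at most $2$ in $H^2(D)\cap H^1_0(D)$; for $r=3$ the choices include the $C^1$ piecewise cubics and the $C^2$ cubic splines vanishing at the endpoints.) Let $P_h:L^2(D)\to\mathsf M_h^r$ be the $L^2(D)$-projection and let $B_h:\mathsf M_h^r\to\mathsf M_h^r$ be defined by $(B_h\varphi,\chi)_{0,D}=(\partial_x^2\varphi,\partial_x^2\chi)_{0,D}$ for all $\varphi,\chi\in\mathsf M_h^r$. Let $W_h^0=P_hw_0$ and let $W_h^1,\dots,W_h^M\in\mathsf M_h^r$ satisfy $$W_h^1-W_h^0+\Delta\tau\,B_hW_h^1=0,\qquad W_h^m-W_h^{m-1}+\Delta\tau\,\big[B_hW_h^m+\mu\,P_h(\partial_x^2W_h^{m-1})\big]=0\quad(m=2,\dots,M).$$ Then there is a constant $C>0$, depending only on $T$, $\mu$ and $r$ (so independent of $\Delta\tau$, of $h$, the partition and $\mathsf M_h^r$, and of $w_0$ and $\theta$), such that $$\Big(\Delta\tau\sum_{m=1}^{M}\|W^m-W_h^m\|_{0,D}^2\Big)^{1/2}\le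 C\,h^{r\theta}\,\|w_0\|_{\dot H^{3\theta-2}}\qquad\forall\,\theta\in[0,1],\ \forall\,w_0\in\dot H^1(D).$$ -/

import Mathlib

open scoped ContDiff

noncomputable section

namespace IMEX

/-- The interval `D = (0,1)`. -/
abbrev D : Set ℝ := Set.Ioo 0 1

/-- The real Hilbert space `L²(D)`; its norm and inner product are the usual ones. -/
abbrev L2D : Type := MeasureTheory.Lp ℝ 2 ((MeasureTheory.volume : MeasureTheory.Measure ℝ).restrict D)

/-- `g ∈ L²(D)` is the generalized derivative `∂ₓᵏ f` of `f ∈ L²(D)`. -/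
def HasWeakDeriv (k : ℕ) (f g : L2D) : Prop :=
  ∀ φ : ℝ → ℝ, ContDiff ℝ ∞ φ → HasCompactSupport φ → tsupport φ ⊆ D →
    ∫ x in D, f x * iteratedDeriv k φ x = (-1) ^ k * ∫ x in D, g x * φ x

/-- The Sobolev space `Hˢ(D)`: all generalized derivatives up to order `s` are in `L²(D)`. -/
def sobolev (s : ℕ) : Set L2D := {v | ∀ k ≤ s, ∃ g : L2D, HasWeakDeriv k v g}

/-- `H¹₀(D)`: the elements of `H¹(D)` whose trace (the boundary value of the continuous
representative) vanishes at both endpoints. -/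
def sobolevZero : Set L2D :=
  {v | v ∈ sobolev 1 ∧ ∃ u : ℝ → ℝ, ContinuousOn u (Set.Icc 0 1) ∧
    (∀ᵐ x ∂(MeasureTheory.volume.restrict D), v x = u x) ∧ u 0 = 0 ∧ u 1 = 0}

/-- `lam i` is `λ_{i+1} = (i+1)π`; the index set `{1,2,…}` is shifted to `ℕ`. -/
def lam (i : ℕ) : ℝ := ((i : ℝ) + 1) * Real.pi

/-- The coefficient `(v, ε_{i+1})` where `ε_k(x) = √2 sin(λ_k x)`. -/
def sineCoeff (v : L2D) (i : ℕ) : ℝ := ∫ x in D, v x * (Real.sqrt 2 * Real.sin (lam i * x))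

/-- The elements `v` of `L²(D)` with `∑ᵢ λᵢ^{2s} (v, εᵢ)² < ∞`. For `s ≥ 0` this is `Ḣˢ(D)`. -/
def dotH (s : ℝ) : Set L2D := {v | Summable fun i => lam i ^ (2 * s) * sineCoeff v i ^ 2}

/-- The norm `‖v‖_{Ḣˢ} = (∑ᵢ λᵢ^{2s} (v, εᵢ)²)^{1/2}` of `v ∈ dotH s`, for any real `s`. -/
def dotNorm (s : ℝ) (v : L2D) : ℝ := Real.sqrt (∑' i, lam i ^ (2 * s) * sineCoeff v i ^ 2)

/-- A partition `0 = x₀ < x₁ < ⋯ < x_J = 1` of `D` into intervals. -/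
structure Partition where
  J : ℕ
  node : Fin (J + 1) → ℝ
  strictMono : StrictMono node
  node_zero : node 0 = 0
  node_last : node (Fin.last J) = 1

/-- The maximum mesh length `h`. -/
def Partition.meshSize (P : Partition) : ℝ := ⨆ j : Fin P.J, (P.node j.succ - P.node j.castSucc)

/-- `v` is, on each interval of the partition, a polynomial of degree at most `r`. -/
def IsPiecewisePoly (P : Partition) (r : ℕ) (v : L2D) : Prop :=
  ∀ j : Fin P.J, ∃ p : Polynomial ℝ, p.natDegree ≤ r ∧
    ∀ᵐ x ∂(MeasureTheory.volume.restrict (Set.Ioo (P.node j.castSucc) (P.node j.succ))),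
      v x = p.eval x

/-- `S` is an `H²`-finite element space of degree `r` over the partition `P`: a subspace of
`H²(D) ∩ H¹₀(D)` of piecewise polynomials of degree at most `r`. Between `H²` (that is, `C¹`) and
the maximal smoothness `Hʳ` (that is, `C^{r-1}`) any inter-element smoothness is allowed, so `S` has
to contain the splines of maximal smoothness. For `r = 2` the two conditions determine `S`; for
`r = 3` they admit `C¹` cubics, `C²` cubic splines, and everything in between. -/
structure IsFESpace (P : Partition) (r : ℕ) (S : Submodule ℝ L2D) : Prop where
  conforming : ∀ v ∈ S, v ∈ sobolev 2 ∧ v ∈ sobolevZero ∧ IsPiecewisePoly P r v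
  full : ∀ v : L2D, v ∈ sobolev r → v ∈ sobolevZero → IsPiecewisePoly P r v → v ∈ S

/-- `p = P_h f`, the `L²(D)`-projection of `f` onto `S`. -/
def IsL2Proj (S : Submodule ℝ L2D) (f p : L2D) : Prop :=
  p ∈ S ∧ ∀ χ ∈ S, inner ℝ p χ = inner ℝ f χ

/-- `b = B_h φ`, where `B_h : S → S` is the discrete biharmonic operator,
`(B_h φ, χ) = (∂ₓ² φ, ∂ₓ² χ)` for all `χ ∈ S`. -/
def IsDiscreteBiharmonic (S : Submodule ℝ L2D) (φ b : L2D) : Prop :=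
  φ ∈ S ∧ b ∈ S ∧ ∃ φ₂ : L2D, HasWeakDeriv 2 φ φ₂ ∧
    ∀ χ ∈ S, ∀ χ₂ : L2D, HasWeakDeriv 2 χ χ₂ → inner ℝ b χ = inner ℝ φ₂ χ₂

/-- `W⁰, …, W^M` are the modified-IMEX time-discrete approximations with time step `Δτ`
(`dt`) and initial value `w₀`. -/
structure IsTimeDiscrete (μ dt : ℝ) (M : ℕ) (w₀ : L2D) (W : ℕ → L2D) : Prop where
  init : W 0 = w₀
  mem : ∀ m, 1 ≤ m → m ≤ M → W m ∈ dotH 4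
  first : ∃ d₄ : L2D, HasWeakDeriv 4 (W 1) d₄ ∧ W 1 - W 0 + dt • d₄ = 0
  step : ∀ m, 2 ≤ m → m ≤ M → ∃ d₄ d₂ : L2D,
    HasWeakDeriv 4 (W m) d₄ ∧ HasWeakDeriv 2 (W (m - 1)) d₂ ∧
      W m - W (m - 1) + dt • (d₄ + μ • d₂) = 0

/-- `W_h⁰, …, W_h^M` are the modified-IMEX fully-discrete approximations in the finite element
space `S`, with time step `Δτ` (`dt`) and initial value `P_h w₀`. -/
structure IsFullyDiscrete (μ dt : ℝ) (M : ℕ) (S : Submodule ℝ L2D) (w₀ : L2D)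
    (Wh : ℕ → L2D) : Prop where
  init : IsL2Proj S w₀ (Wh 0)
  mem : ∀ m ≤ M, Wh m ∈ S
  first : ∃ b : L2D, IsDiscreteBiharmonic S (Wh 1) b ∧ Wh 1 - Wh 0 + dt • b = 0
  step : ∀ m, 2 ≤ m → m ≤ M → ∃ b d₂ p : L2D,
    IsDiscreteBiharmonic S (Wh m) b ∧ HasWeakDeriv 2 (Wh (m - 1)) d₂ ∧ IsL2Proj S d₂ p ∧
      Wh m - Wh (m - 1) + dt • (b + μ • p) = 0

end IMEX

end

/-! Everything is rewritten with the biharmonic operator inverted, so that no derivatives remain.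
Let `G` be the inverse of the Dirichlet Laplacian and `Q` the `L²` projection onto the closure of
the second derivatives of the elements of `S`. Then `G ∘ G` inverts `∂ₓ⁴` on `Ḣ⁴`, while `G ∘ Q ∘ G`
equals `B_h⁻¹ P_h`. Both methods thus become one recursion, `IsScheme`, with `Q` the identity or the
projection. Closures ensure that projections exist without a dimension count.

One energy estimate, `IsScheme.stability`, serves both: testing with the new iterate bounds the
discrete `L²` norm in time by `‖Q G x₀‖` and the residuals, for every step size. With no residual
this is the case `θ = 0`, since `‖G x₀‖` is the `Ḣ⁻²` norm (`error_le_of_rough`).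

For `θ = 1` the time-discrete solution is inserted into the fully discrete recursion. Its residual
is a Ritz projection error, bounded by `2 h^r` times the norm of the third derivative
(`norm_ritz_error_le`, a duality argument). Those third derivatives are summed in time by applying
the same stability lemma to each Fourier mode (`IsScheme.sum_sineCoeff_sq_le`).

Intermediate `θ` follow by cutting the initial value at the frequency `h^(-r/3)`, with the smooth
estimate for the low modes and the rough one for the rest (`error_sq_le`). -/

noncomputable section

open scoped ContDiff
open MeasureTheory Set Filter Topology

namespace IMEX

/-! ### The space `L²(D)` -/

abbrev volD : Measure ℝ := volume.restrict D

instance : IsProbabilityMeasure volD := ⟨by simp [volD, D]⟩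

lemma integral_D_eq_intervalIntegral (f : ℝ → ℝ) : ∫ x in D, f x = ∫ x in (0 : ℝ)..1, f x := by
  rw [intervalIntegral.integral_of_le zero_le_one, integral_Ioc_eq_integral_Ioo]

lemma inner_L2D (f g : L2D) : inner ℝ f g = ∫ x in D, f x * g x := by
  rw [L2.inner_def]
  simp [mul_comm]

lemma norm_sq_L2D (f : L2D) : ‖f‖ ^ 2 = ∫ x in D, f x ^ 2 := by
  rw [← real_inner_self_eq_norm_sq, inner_L2D]
  simp [sq]

lemma memLp_coe (f : L2D) : MemLp f 2 volD := Lp.memLp f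

lemma integrable_coe (f : L2D) : Integrable f volD := (memLp_coe f).integrable one_le_two

lemma intervalIntegrable_coe (f : L2D) : IntervalIntegrable f volume 0 1 :=
  (intervalIntegrable_iff_integrableOn_Ioo_of_le zero_le_one).2 (integrable_coe f)

lemma intervalIntegrable_coe_of_mem (f : L2D) {a b : ℝ} (ha : a ∈ Icc (0 : ℝ) 1)
    (hb : b ∈ Icc (0 : ℝ) 1) : IntervalIntegrable f volume a b :=
  (intervalIntegrable_coe f).mono_set
    (by rw [uIcc_of_le zero_le_one]; exact uIcc_subset_Icc ha hb)

lemma memLp_of_continuousOn {u : ℝ → ℝ} (hu : ContinuousOn u (Icc 0 1)) : MemLp u 2 volD := by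
  have h : MemLp u 2 (volume.restrict (Icc (0 : ℝ) 1)) := by
    obtain ⟨C, hC⟩ := isCompact_Icc.exists_bound_of_continuousOn hu
    refine MemLp.of_bound (hu.aestronglyMeasurable measurableSet_Icc) C ?_
    exact (ae_restrict_iff' measurableSet_Icc).2 (ae_of_all _ hC)
  exact h.mono_measure (Measure.restrict_mono Ioo_subset_Icc_self le_rfl)

/-- The class in `L²(D)` of a function that is continuous on `[0,1]`. -/
def ofCont (u : ℝ → ℝ) (hu : ContinuousOn u (Icc 0 1)) : L2D := (memLp_of_continuousOn hu).toLp u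

lemma coeFn_ofCont (u : ℝ → ℝ) (hu : ContinuousOn u (Icc 0 1)) : ofCont u hu =ᵐ[volD] u :=
  MemLp.coeFn_toLp _

lemma ae_volD {p : ℝ → Prop} (h : ∀ x ∈ D, p x) : ∀ᵐ x ∂volD, p x :=
  (ae_restrict_iff' measurableSet_Ioo).2 (ae_of_all _ h)

/-- The constant function `1`. -/
def one : L2D := ofCont (fun _ => 1) continuousOn_const

lemma coeFn_one : one =ᵐ[volD] fun _ => (1 : ℝ) := coeFn_ofCont _ _

lemma inner_one (f : L2D) : inner ℝ f one = ∫ x in D, f x := by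
  rw [inner_L2D]
  refine integral_congr_ae ?_
  filter_upwards [coeFn_one] with x hx
  rw [hx, mul_one]

lemma norm_one_L2D : ‖one‖ = 1 := by
  have h : ‖one‖ ^ 2 = 1 := by
    rw [← real_inner_self_eq_norm_sq, inner_one, integral_congr_ae coeFn_one]
    simp
  nlinarith [norm_nonneg one]

lemma inner_ofCont (f : L2D) (u : ℝ → ℝ) (hu : ContinuousOn u (Icc 0 1)) :
    inner ℝ f (ofCont u hu) = ∫ x in D, f x * u x := by
  rw [inner_L2D]
  refine integral_congr_ae ?_
  filter_upwards [coeFn_ofCont u hu] with x hx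
  rw [hx]

/-! ### The Volterra operator -/

/-- The primitive of `f` that vanishes at `0`. -/
def prim (f : ℝ → ℝ) (x : ℝ) : ℝ := ∫ t in (0 : ℝ)..x, f t

lemma prim_zero (f : ℝ → ℝ) : prim f 0 = 0 := intervalIntegral.integral_same

lemma prim_congr {f g : ℝ → ℝ} (h : f =ᵐ[volD] g) {x : ℝ} (hx : x ∈ Icc (0 : ℝ) 1) :
    prim f x = prim g x := by
  refine intervalIntegral.integral_congr_ae ?_
  have h1 := (ae_restrict_iff' measurableSet_Ioo).1 h
  -- For `x = 1` the half-open interval `(0,x]` contains the point `1`, which is not in `D`.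
  have h2 : ∀ᵐ y : ℝ, y ≠ 1 := by simp [ae_iff]
  filter_upwards [h1, h2] with y hy hy1 hyx
  rw [uIoc_of_le hx.1] at hyx
  exact hy ⟨hyx.1, lt_of_le_of_ne (hyx.2.trans hx.2) hy1⟩

lemma prim_one_eq (f : L2D) : prim f 1 = inner ℝ f one := by
  rw [inner_one, integral_D_eq_intervalIntegral, prim]

lemma absolutelyContinuous_prim (f : L2D) : AbsolutelyContinuousOnInterval (prim f) 0 1 :=
  (intervalIntegrable_coe f).absolutelyContinuousOnInterval_intervalIntegral (by simp)

lemma continuousOn_prim (f : L2D) : ContinuousOn (prim f) (Icc 0 1) := by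
  simpa [uIcc_of_le] using (absolutelyContinuous_prim f).continuousOn

lemma prim_sub_prim (f : L2D) {a b : ℝ} (ha : a ∈ Icc (0 : ℝ) 1) (hb : b ∈ Icc (0 : ℝ) 1) :
    prim f b - prim f a = ∫ t in a..b, f t := by
  have h0 : (0 : ℝ) ∈ Icc (0 : ℝ) 1 := by simp
  rw [prim, prim, intervalIntegral.integral_interval_sub_left]
  · exact intervalIntegrable_coe_of_mem f h0 hb
  · exact intervalIntegrable_coe_of_mem f h0 ha

/-- Cauchy-Schwarz on an interval. -/
lemma sq_intervalIntegral_le (f : L2D) {a b : ℝ} (ha : 0 ≤ a) (hab : a ≤ b) (hb : b ≤ 1) :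
    (∫ t in a..b, f t) ^ 2 ≤ (b - a) * ∫ t in a..b, f t ^ 2 := by
  have hf : IntervalIntegrable f volume a b :=
    intervalIntegrable_coe_of_mem f ⟨ha, hab.trans hb⟩ ⟨ha.trans hab, hb⟩
  have hf2 : IntervalIntegrable (fun t => f t ^ 2) volume a b := by
    have h : IntervalIntegrable (fun t => f t ^ 2) volume 0 1 :=
      (intervalIntegrable_iff_integrableOn_Ioo_of_le zero_le_one).2 (memLp_coe f).integrable_sq
    refine h.mono_set ?_
    rw [uIcc_of_le zero_le_one]
    exact uIcc_subset_Icc ⟨ha, hab.trans hb⟩ ⟨ha.trans hab, hb⟩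
  rcases hab.eq_or_lt with rfl | hlt
  · simp
  -- The mean of `f`; the inequality is the nonnegativity of its variance.
  set m := (∫ t in a..b, f t) / (b - a) with hm
  have hba : 0 < b - a := sub_pos.2 hlt
  have key : 0 ≤ ∫ t in a..b, (f t ^ 2 - 2 * m * f t + m ^ 2) := by
    refine intervalIntegral.integral_nonneg hab fun t _ => ?_
    nlinarith [sq_nonneg (f t - m)]
  rw [intervalIntegral.integral_add (hf2.sub (hf.const_mul _)) (by simp),
    intervalIntegral.integral_sub hf2 (hf.const_mul _), intervalIntegral.integral_const_mul,
    intervalIntegral.integral_const] at key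
  have hI : ∫ t in a..b, f t = m * (b - a) := by rw [hm]; field_simp
  rw [hI] at key ⊢
  simp only [smul_eq_mul] at key
  nlinarith

lemma abs_prim_le (f : L2D) {x : ℝ} (hx : x ∈ Icc (0 : ℝ) 1) : |prim f x| ≤ ‖f‖ := by
  refine abs_le_of_sq_le_sq ?_ (norm_nonneg f)
  have h := sq_intervalIntegral_le f le_rfl hx.1 hx.2
  have hn : 0 ≤ ∫ t in (0 : ℝ)..x, f t ^ 2 :=
    intervalIntegral.integral_nonneg hx.1 fun t _ => sq_nonneg _
  have hle : ∫ t in (0 : ℝ)..x, f t ^ 2 ≤ ‖f‖ ^ 2 := by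
    rw [norm_sq_L2D, integral_D_eq_intervalIntegral]
    refine intervalIntegral.integral_mono_interval le_rfl hx.1 hx.2
      (ae_of_all _ fun t => sq_nonneg _) ?_
    exact (intervalIntegrable_iff_integrableOn_Ioo_of_le zero_le_one).2 (memLp_coe f).integrable_sq
  calc prim f x ^ 2 ≤ (x - 0) * ∫ t in (0 : ℝ)..x, f t ^ 2 := h
    _ ≤ 1 * ∫ t in (0 : ℝ)..x, f t ^ 2 := by gcongr; linarith [hx.2]
    _ ≤ ‖f‖ ^ 2 := by linarith

lemma norm_le_of_ae_abs_le {f : L2D} {c : ℝ} (hc : 0 ≤ c) (h : ∀ᵐ x ∂volD, |f x| ≤ c) :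
    ‖f‖ ≤ c := by
  have h1 : measureUnivNNReal volD = 1 := by simp [measureUnivNNReal]
  have h2 := Lp.norm_le_of_ae_bound (p := 2) hc (f := f) (by simpa using h)
  rwa [h1, NNReal.coe_one, Real.one_rpow, one_mul] at h2

/-- The Volterra operator `(K f)(x) = ∫₀ˣ f`. -/
def K : L2D →L[ℝ] L2D :=
  LinearMap.mkContinuous
    { toFun := fun f => ofCont (prim f) (continuousOn_prim f)
      map_add' := fun f g => by
        refine Lp.ext ?_
        filter_upwards [coeFn_ofCont _ (continuousOn_prim (f + g)), Lp.coeFn_add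
          (ofCont _ (continuousOn_prim f)) (ofCont _ (continuousOn_prim g)),
          coeFn_ofCont _ (continuousOn_prim f), coeFn_ofCont _ (continuousOn_prim g),
          ae_volD fun x hx => hx] with x h1 h2 h3 h4 hx
        have hx' := Ioo_subset_Icc_self hx
        rw [h1, h2, Pi.add_apply, h3, h4, prim_congr (Lp.coeFn_add f g) hx']
        exact intervalIntegral.integral_add (intervalIntegrable_coe_of_mem f (by simp) hx')
          (intervalIntegrable_coe_of_mem g (by simp) hx')
      map_smul' := fun c f => by
        refine Lp.ext ?_
        filter_upwards [coeFn_ofCont _ (continuousOn_prim (c • f)), Lp.coeFn_smul c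
          (ofCont _ (continuousOn_prim f)), coeFn_ofCont _ (continuousOn_prim f),
          ae_volD fun x hx => hx] with x h1 h2 h3 hx
        have hx' := Ioo_subset_Icc_self hx
        rw [h1, RingHom.id_apply, h2, Pi.smul_apply, h3, prim_congr (Lp.coeFn_smul c f) hx']
        exact intervalIntegral.integral_smul c _ } 1
    (fun f => by
      rw [one_mul]
      refine norm_le_of_ae_abs_le (norm_nonneg f) ?_
      filter_upwards [coeFn_ofCont _ (continuousOn_prim f), ae_volD fun x hx => hx] with x h1 hx
      exact h1 ▸ abs_prim_le f (Ioo_subset_Icc_self hx))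

lemma coeFn_K (f : L2D) : K f =ᵐ[volD] prim f := coeFn_ofCont _ (continuousOn_prim f)

lemma norm_K_le (f : L2D) : ‖K f‖ ≤ ‖f‖ := by
  refine norm_le_of_ae_abs_le (norm_nonneg f) ?_
  filter_upwards [coeFn_K f, ae_volD fun x hx => hx] with x h1 hx
  exact h1 ▸ abs_prim_le f (Ioo_subset_Icc_self hx)

lemma deriv_prim_ae (f : L2D) : ∀ᵐ x ∂volD, deriv (prim f) x = f x := by
  refine (ae_restrict_iff' measurableSet_Ioo).2 ?_
  filter_upwards [(intervalIntegrable_coe f).ae_hasDerivAt_integral] with x hx hxD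
  refine (hx ?_ 0 (by simp)).deriv
  rw [uIcc_of_le zero_le_one]
  exact Ioo_subset_Icc_self hxD

/-- Integration by parts. -/
lemma inner_K_add_inner_K (f g : L2D) :
    inner ℝ (K f) g + inner ℝ f (K g) = inner ℝ f one * inner ℝ g one := by
  have h := (absolutelyContinuous_prim f).integral_mul_deriv_eq_deriv_mul
    (absolutelyContinuous_prim g)
  rw [prim_zero, zero_mul, sub_zero, prim_one_eq, prim_one_eq, ← integral_D_eq_intervalIntegral,
    ← integral_D_eq_intervalIntegral] at h
  have h1 : inner ℝ (K f) g = ∫ x in D, prim f x * deriv (prim g) x := by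
    rw [inner_L2D]
    refine integral_congr_ae ?_
    filter_upwards [coeFn_K f, deriv_prim_ae g] with x hx hx'
    rw [hx, hx']
  have h2 : inner ℝ f (K g) = ∫ x in D, deriv (prim f) x * prim g x := by
    rw [inner_L2D]
    refine integral_congr_ae ?_
    filter_upwards [coeFn_K g, deriv_prim_ae f] with x hx hx'
    rw [hx, hx']
  rw [h1, h2, h]
  ring

/-- The fundamental theorem of calculus in operator form. -/
lemma K_ofCont_deriv {u u' : ℝ → ℝ} (hu : ∀ x, HasDerivAt u (u' x) x) (hc : Continuous u') :
    K (ofCont u' hc.continuousOn) =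
      ofCont u (fun x _ => (hu x).continuousAt.continuousWithinAt) - u 0 • one := by
  refine Lp.ext ?_
  filter_upwards [coeFn_K (ofCont u' hc.continuousOn), Lp.coeFn_sub
    (ofCont u (fun x _ => (hu x).continuousAt.continuousWithinAt)) (u 0 • one),
    coeFn_ofCont u (fun x _ => (hu x).continuousAt.continuousWithinAt), Lp.coeFn_smul (u 0) one,
    coeFn_one, ae_volD fun x hx => hx] with x h1 h2 h3 h4 h5 hx
  rw [h1, h2, Pi.sub_apply, h3, h4, Pi.smul_apply, h5,
    prim_congr (coeFn_ofCont u' _) (Ioo_subset_Icc_self hx), prim,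
    intervalIntegral.integral_eq_sub_of_hasDerivAt (fun y _ => hu y)
      (hc.intervalIntegrable _ _)]
  simp

/-! ### The inverse of the Dirichlet Laplacian -/

/-- The solution operator of `u'' = f`, `u(0) = u(1) = 0`. -/
def G : L2D →L[ℝ] L2D := K ∘L K - ((innerSL ℝ one) ∘L K).smulRight (K one)

lemma G_apply (f : L2D) : G f = K (K f) - inner ℝ (K f) one • K one := by
  simp [G, real_inner_comm]

/-- The argument of the outer `K` is the derivative of `G f`: a primitive of `f` normalised to mean
zero, which makes `G f` vanish at `1`. -/
lemma G_eq_K (f : L2D) : G f = K (K f - inner ℝ (K f) one • one) := by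
  rw [G_apply, map_sub, map_smul]

lemma inner_K_one (f : L2D) : inner ℝ (K f) one = inner ℝ f one - inner ℝ f (K one) := by
  have h := inner_K_add_inner_K f one
  rw [real_inner_self_eq_norm_sq, norm_one_L2D] at h
  linarith

/-- The adjoint of `K` is `-K` plus a rank-one boundary term; the boundary terms of two integrations
by parts cancel against the rank-one correction in `G`. -/
lemma inner_G_comm (f g : L2D) : inner ℝ (G f) g = inner ℝ f (G g) := by
  have h1 := inner_K_add_inner_K (K f) g
  have h2 := inner_K_add_inner_K f (K g)
  have h3 := inner_K_one f
  have h4 := inner_K_one g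
  rw [G_apply, G_apply, inner_sub_left, inner_sub_right, inner_smul_left, inner_smul_right,
    real_inner_comm g (K one)]
  simp only [conj_trivial]
  have h5 : inner ℝ f (K one) = inner ℝ f one - inner ℝ (K f) one := by linarith
  have h6 : inner ℝ g (K one) = inner ℝ g one - inner ℝ (K g) one := by linarith
  rw [h5, h6]
  nlinarith

/-! ### Weak derivatives -/

/-- A test function on `D`. -/
structure IsTest (φ : ℝ → ℝ) : Prop where
  smooth : ContDiff ℝ ∞ φ
  compact : HasCompactSupport φ
  supp : tsupport φ ⊆ D

namespace IsTest

variable {φ : ℝ → ℝ} (h : IsTest φ)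
include h

lemma continuousOn : ContinuousOn φ (Icc 0 1) := h.smooth.continuous.continuousOn

lemma eq_zero {x : ℝ} (hx : x ∉ D) : φ x = 0 :=
  image_eq_zero_of_notMem_tsupport fun hx' => hx (h.supp hx')

lemma hasDerivAt (x : ℝ) : HasDerivAt φ (deriv φ x) x :=
  (h.smooth.differentiable (by simp) x).hasDerivAt

lemma deriv : IsTest (deriv φ) where
  smooth := (contDiff_infty_iff_deriv.1 h.smooth).2
  compact := h.compact.deriv
  supp := (closure_minimal (support_deriv_subset) (isClosed_tsupport φ)).trans h.supp

lemma iteratedDeriv (k : ℕ) : IsTest (iteratedDeriv k φ) := by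
  induction k with
  | zero => simpa using h
  | succ k ih => rw [iteratedDeriv_succ]; exact ih.deriv

lemma K_deriv : K (ofCont (_root_.deriv φ) h.deriv.continuousOn) = ofCont φ h.continuousOn := by
  have := K_ofCont_deriv h.hasDerivAt h.deriv.smooth.continuous
  rw [this, h.eq_zero (by simp), zero_smul, sub_zero]

lemma inner_deriv_one : inner ℝ (ofCont (_root_.deriv φ) h.deriv.continuousOn) one = 0 := by
  rw [inner_one, integral_congr_ae (coeFn_ofCont _ _), integral_D_eq_intervalIntegral,
    intervalIntegral.integral_eq_sub_of_hasDerivAt (fun y _ => h.hasDerivAt y)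
      (h.deriv.smooth.continuous.intervalIntegrable _ _),
    h.eq_zero (by simp), h.eq_zero (by simp), sub_zero]

end IsTest

lemma hasWeakDeriv_iff {k : ℕ} {f g : L2D} : HasWeakDeriv k f g ↔ ∀ φ (h : IsTest φ),
    inner ℝ f (ofCont _ (h.iteratedDeriv k).continuousOn) =
      (-1) ^ k * inner ℝ g (ofCont φ h.continuousOn) := by
  simp only [inner_ofCont]
  exact ⟨fun H φ h => H φ h.1 h.2 h.3, fun H φ h1 h2 h3 => H φ ⟨h1, h2, h3⟩⟩

lemma eq_zero_of_forall_test {f : L2D} (H : ∀ φ (h : IsTest φ),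
    inner ℝ f (ofCont φ h.continuousOn) = 0) : f = 0 := by
  have hloc : LocallyIntegrableOn f D volume :=
    IntegrableOn.locallyIntegrableOn (integrable_coe f)
  have key := IsOpen.ae_eq_zero_of_integral_contDiff_smul_eq_zero isOpen_Ioo hloc
    (fun φ h1 h2 h3 => by
      have h : IsTest φ := ⟨h1, h2, h3⟩
      have := H φ h
      rw [inner_ofCont] at this
      rw [← setIntegral_eq_integral_of_forall_compl_eq_zero (s := D)
        (fun x hx => by rw [h.eq_zero hx, zero_smul]), ← this]
      simp [mul_comm])
  refine Lp.ext ?_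
  filter_upwards [(ae_restrict_iff' measurableSet_Ioo).2 key, Lp.coeFn_zero ℝ 2 volD] with x h1 h2
  rw [h1, h2, Pi.zero_apply]

lemma HasWeakDeriv.unique {k : ℕ} {f g g' : L2D} (h : HasWeakDeriv k f g)
    (h' : HasWeakDeriv k f g') : g = g' := by
  rw [hasWeakDeriv_iff] at h h'
  refine sub_eq_zero.1 (eq_zero_of_forall_test fun φ hφ => ?_)
  have := (h φ hφ).symm.trans (h' φ hφ)
  rw [inner_sub_left, sub_eq_zero]
  exact mul_left_cancel₀ (pow_ne_zero k (by norm_num)) this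

lemma HasWeakDeriv.smul {k : ℕ} {f g : L2D} (c : ℝ) (h : HasWeakDeriv k f g) :
    HasWeakDeriv k (c • f) (c • g) := by
  rw [hasWeakDeriv_iff] at *
  intro φ hφ
  rw [real_inner_smul_left, real_inner_smul_left, h φ hφ]
  ring

lemma HasWeakDeriv.sub {k : ℕ} {f g f' g' : L2D} (h : HasWeakDeriv k f g)
    (h' : HasWeakDeriv k f' g') : HasWeakDeriv k (f - f') (g - g') := by
  rw [hasWeakDeriv_iff] at *
  intro φ hφ
  rw [inner_sub_left, inner_sub_left, h φ hφ, h' φ hφ, mul_sub]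

lemma hasWeakDeriv_zero (f : L2D) : HasWeakDeriv 0 f f := by
  intro φ _ _ _
  simp

lemma HasWeakDeriv.trans {j k : ℕ} {f g l : L2D} (h : HasWeakDeriv j f g)
    (h' : HasWeakDeriv k g l) : HasWeakDeriv (j + k) f l := by
  intro φ h1 h2 h3
  have hφ : IsTest φ := ⟨h1, h2, h3⟩
  have ht := hφ.iteratedDeriv k
  have e : iteratedDeriv j (iteratedDeriv k φ) = iteratedDeriv (j + k) φ := by
    simp only [iteratedDeriv_eq_iterate, Function.iterate_add_apply]
  rw [← e, h _ ht.1 ht.2 ht.3, h' φ h1 h2 h3, pow_add, mul_assoc]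

lemma hasWeakDeriv_K (f : L2D) : HasWeakDeriv 1 (K f) f := by
  rw [hasWeakDeriv_iff]
  intro φ hφ
  have h := inner_K_add_inner_K f (ofCont _ hφ.deriv.continuousOn)
  rw [hφ.K_deriv, hφ.inner_deriv_one, mul_zero] at h
  simp only [iteratedDeriv_one]
  linarith

lemma hasWeakDeriv_one : HasWeakDeriv 1 one 0 := by
  rw [hasWeakDeriv_iff]
  intro φ hφ
  simp only [iteratedDeriv_one]
  rw [real_inner_comm, hφ.inner_deriv_one, inner_zero_left, mul_zero]

lemma hasWeakDeriv_G_one (f : L2D) :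
    HasWeakDeriv 1 (G f) (K f - inner ℝ (K f) one • one) := by
  rw [G_eq_K]
  exact hasWeakDeriv_K _

lemma hasWeakDeriv_K_sub_smul_one (f : L2D) (c : ℝ) : HasWeakDeriv 1 (K f - c • one) f := by
  simpa using (hasWeakDeriv_K f).sub (hasWeakDeriv_one.smul c)

lemma hasWeakDeriv_G (f : L2D) : HasWeakDeriv 2 (G f) f :=
  (hasWeakDeriv_G_one f).trans (hasWeakDeriv_K_sub_smul_one f _)

lemma hasWeakDeriv_G_G (f : L2D) : HasWeakDeriv 4 (G (G f)) f :=
  (hasWeakDeriv_G (G f)).trans (hasWeakDeriv_G f)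

lemma G_injective : Function.Injective G := by
  refine (injective_iff_map_eq_zero G).2 fun f hf => ?_
  have h := hasWeakDeriv_G f
  rw [hf] at h
  refine h.unique ?_
  simpa using (hasWeakDeriv_G 0)

/-- The primitive of a test function with mean zero is a test function. -/
lemma IsTest.prim {φ : ℝ → ℝ} (h : IsTest φ) (h0 : ∫ x in (0 : ℝ)..1, φ x = 0) :
    IsTest (prim φ) ∧ _root_.deriv (IMEX.prim φ) = φ := by
  have hc := h.smooth.continuous
  have hd : ∀ x, HasDerivAt (IMEX.prim φ) (φ x) x := fun x =>
    intervalIntegral.integral_hasDerivAt_right (hc.intervalIntegrable _ _)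
      (hc.stronglyMeasurableAtFilter _ _) hc.continuousAt
  have hderiv : _root_.deriv (IMEX.prim φ) = φ := funext fun x => (hd x).deriv
  have hsm : ContDiff ℝ ∞ (IMEX.prim φ) :=
    contDiff_infty_iff_deriv.2 ⟨fun x => (hd x).differentiableAt, by rw [hderiv]; exact h.smooth⟩
  -- The primitive is supported in the same interval: left of `a` nothing has been integrated yet,
  -- right of `b` the whole integral, zero, has been. For empty support `Icc 1 0` is the empty set.
  obtain ⟨a, b, ha, hb, hab⟩ : ∃ a b : ℝ, 0 < a ∧ b < 1 ∧ tsupport φ ⊆ Icc a b := by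
    rcases (tsupport φ).eq_empty_or_nonempty with he | hne
    · exact ⟨1, 0, by norm_num, by norm_num, by simp [he]⟩
    · exact ⟨sInf (tsupport φ), sSup (tsupport φ), (h.supp (h.compact.sInf_mem hne)).1,
        (h.supp (h.compact.sSup_mem hne)).2, fun x hx =>
          ⟨csInf_le h.compact.bddBelow hx, le_csSup h.compact.bddAbove hx⟩⟩
  have hz : ∀ x, x ∉ Icc a b → φ x = 0 := fun x hx =>
    image_eq_zero_of_notMem_tsupport fun hx' => hx (hab hx')
  have hsub : tsupport (IMEX.prim φ) ⊆ Icc a b := by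
    refine closure_minimal (fun x hx => ?_) isClosed_Icc
    by_contra hxn
    refine hx ?_
    rcases lt_or_ge x a with hxa | hxa
    · have : ∀ t ∈ uIcc 0 x, φ t = 0 := fun t ht => hz t fun ht' => by
        rcases le_total 0 x with h0x | h0x
        · rw [uIcc_of_le h0x] at ht; linarith [ht.2, ht'.1]
        · rw [uIcc_of_ge h0x] at ht; linarith [ht.2, ht'.1]
      rw [IMEX.prim, intervalIntegral.integral_congr this]
      simp
    · have hxb : b < x := lt_of_not_ge fun hb' => hxn ⟨hxa, hb'⟩
      have : ∀ t ∈ uIcc 1 x, φ t = 0 := fun t ht => hz t fun ht' => by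
        rcases le_total 1 x with h0x | h0x
        · rw [uIcc_of_le h0x] at ht; linarith [ht.1, ht'.2]
        · rw [uIcc_of_ge h0x] at ht; linarith [ht.1, ht'.2]
      rw [IMEX.prim, ← intervalIntegral.integral_add_adjacent_intervals (b := 1)
        (hc.intervalIntegrable _ _) (hc.intervalIntegrable _ _), h0,
        intervalIntegral.integral_congr this]
      simp
  refine ⟨⟨hsm, ?_, hsub.trans fun x hx => ⟨ha.trans_le hx.1, hx.2.trans_lt hb⟩⟩, hderiv⟩
  exact isCompact_Icc.of_isClosed_subset (isClosed_tsupport _) hsub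

lemma ofCont_congr {u v : ℝ → ℝ} (huv : u = v) (hu : ContinuousOn u (Icc 0 1)) :
    ofCont u hu = ofCont v (huv ▸ hu) := by subst huv; rfl

lemma exists_isTest_integral_eq_one :
    ∃ ψ : ℝ → ℝ, IsTest ψ ∧ ∫ x in (0 : ℝ)..1, ψ x = 1 := by
  let b : ContDiffBump (1 / 2 : ℝ) := ⟨1 / 8, 1 / 4, by norm_num, by norm_num⟩
  have ht : IsTest (b.normed volume) := by
    refine ⟨b.contDiff_normed, b.hasCompactSupport_normed, ?_⟩
    rw [b.tsupport_normed_eq, Real.closedBall_eq_Icc]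
    intro x hx
    have h1 : (1 / 2 - 1 / 4 : ℝ) ≤ x := hx.1
    have h2 : x ≤ (1 / 2 + 1 / 4 : ℝ) := hx.2
    constructor <;> linarith
  refine ⟨b.normed volume, ht, ?_⟩
  rw [← integral_D_eq_intervalIntegral,
    setIntegral_eq_integral_of_forall_compl_eq_zero fun x hx => ht.eq_zero hx]
  exact b.integral_normed

/-- The lemma of du Bois-Reymond. -/
lemma exists_eq_smul_one_of_hasWeakDeriv_zero {w : L2D} (hw : HasWeakDeriv 1 w 0) :
    ∃ c : ℝ, w = c • one := by
  obtain ⟨ψ, hψ, hψ1⟩ := exists_isTest_integral_eq_one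
  refine ⟨inner ℝ w (ofCont ψ hψ.continuousOn), ?_⟩
  refine sub_eq_zero.1 (eq_zero_of_forall_test fun φ hφ => ?_)
  set m := ∫ x in (0 : ℝ)..1, φ x with hm
  -- Subtracting `m ψ` makes the mean zero, so the result is the derivative of a test function and
  -- `w` annihilates it.
  have hη : IsTest (fun x => φ x - m * ψ x) := by
    refine ⟨hφ.1.sub (contDiff_const.mul hψ.1), hφ.2.sub hψ.2.mul_left, ?_⟩
    have h1 := tsupport_sub φ (fun x => m * ψ x)
    refine h1.trans (union_subset hφ.3 ?_)
    exact (tsupport_mul_subset_right (f := fun _ => m) (g := ψ)).trans hψ.3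
  have h0 : ∫ x in (0 : ℝ)..1, (φ x - m * ψ x) = 0 := by
    rw [intervalIntegral.integral_sub (hφ.1.continuous.intervalIntegrable _ _)
      ((hψ.1.continuous.intervalIntegrable _ _).const_mul _),
      intervalIntegral.integral_const_mul, hψ1, ← hm]
    ring
  obtain ⟨hp, hpd⟩ := hη.prim h0
  have h := (hasWeakDeriv_iff.1 hw) _ hp
  rw [inner_zero_left, mul_zero] at h
  simp only [iteratedDeriv_one] at h
  rw [ofCont_congr hpd] at h
  have e : ofCont _ hη.continuousOn =
      ofCont φ hφ.continuousOn - m • ofCont ψ hψ.continuousOn := by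
    refine Lp.ext ?_
    filter_upwards [coeFn_ofCont _ hη.continuousOn, coeFn_ofCont _ hφ.continuousOn,
      coeFn_ofCont _ hψ.continuousOn, Lp.coeFn_sub (ofCont φ hφ.continuousOn)
        (m • ofCont ψ hψ.continuousOn), Lp.coeFn_smul m (ofCont ψ hψ.continuousOn)]
      with x h1 h2 h3 h4 h5
    rw [h1, h4, Pi.sub_apply, h5, Pi.smul_apply, h2, h3, smul_eq_mul]
  have h1 : inner ℝ one (ofCont φ hφ.continuousOn) = m := by
    rw [real_inner_comm, inner_one, integral_congr_ae (coeFn_ofCont _ _),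
      integral_D_eq_intervalIntegral]
  rw [e, inner_sub_right, real_inner_smul_right] at h
  rw [inner_sub_left, real_inner_smul_left, h1]
  linarith

lemma HasWeakDeriv.eq_K_add {v g : L2D} (h : HasWeakDeriv 1 v g) :
    ∃ c : ℝ, v = K g + c • one := by
  have h0 : HasWeakDeriv 1 (v - K g) 0 := by simpa using h.sub (hasWeakDeriv_K g)
  obtain ⟨c, hc⟩ := exists_eq_smul_one_of_hasWeakDeriv_zero h0
  exact ⟨c, by rw [← hc]; abel⟩

lemma eq_on_Icc_of_ae_eq {u v : ℝ → ℝ} (hu : ContinuousOn u (Icc 0 1))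
    (hv : ContinuousOn v (Icc 0 1)) (h : u =ᵐ[volD] v) : EqOn u v (Icc 0 1) := by
  have h1 : EqOn u v (Ioo 0 1) :=
    Measure.eqOn_open_of_ae_eq h isOpen_Ioo (hu.mono Ioo_subset_Icc_self)
      (hv.mono Ioo_subset_Icc_self)
  refine h1.of_subset_closure hu hv Ioo_subset_Icc_self ?_
  rw [closure_Ioo (by norm_num)]

/-- An element of `H²(D) ∩ H¹₀(D)` is recovered from its second derivative. -/
lemma eq_G_of_hasWeakDeriv {v v₂ : L2D} (h2 : v ∈ sobolev 2) (h0 : v ∈ sobolevZero)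
    (h : HasWeakDeriv 2 v v₂) : v = G v₂ := by
  obtain ⟨g, hg⟩ := h2 1 (by norm_num)
  -- Both `(v₂, φ)` and `-(g, φ')` equal `(v, φ'')`.
  have hgv : HasWeakDeriv 1 g v₂ := by
    intro φ h1 h2 h3
    have hφ : IsTest φ := ⟨h1, h2, h3⟩
    have e1 := h φ h1 h2 h3
    have e2 := hg _ hφ.deriv.1 hφ.deriv.2 hφ.deriv.3
    rw [← iteratedDeriv_succ'] at e2
    rw [iteratedDeriv_one]
    norm_num at e1 e2 ⊢
    linarith
  obtain ⟨d, rfl⟩ := hgv.eq_K_add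
  obtain ⟨c, rfl⟩ := hg.eq_K_add
  obtain ⟨-, u, hu, hae, hu0, hu1⟩ := h0
  have hcont : ContinuousOn (fun x => prim (K v₂ + d • one : L2D) x + c) (Icc 0 1) :=
    (continuousOn_prim _).add continuousOn_const
  have hE : EqOn u (fun x => prim (K v₂ + d • one : L2D) x + c) (Icc 0 1) := by
    refine eq_on_Icc_of_ae_eq hu hcont ?_
    filter_upwards [hae, Lp.coeFn_add (K (K v₂ + d • one)) (c • one),
      coeFn_K (K v₂ + d • one), Lp.coeFn_smul c one, coeFn_one] with x h1 h2 h3 h4 h5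
    rw [← h1, h2, Pi.add_apply, h3, h4, Pi.smul_apply, h5, smul_eq_mul, mul_one]
  -- The two boundary values fix the two constants of integration.
  have e0 := hE (x := 0) (by simp)
  have e1 := hE (x := 1) (by simp)
  simp only [prim_zero, hu0, hu1, zero_add] at e0 e1
  rw [prim_one_eq, inner_add_left, real_inner_smul_left, real_inner_self_eq_norm_sq,
    norm_one_L2D] at e1
  have hd : d = -inner ℝ (K v₂) one := by linarith
  rw [G_eq_K, ← e0, hd, zero_smul, add_zero, neg_smul, sub_eq_add_neg]

/-! ### The sine basis -/

lemma lam_pos (i : ℕ) : 0 < lam i := by unfold lam; positivity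

lemma one_le_lam (i : ℕ) : 1 ≤ lam i := by
  unfold lam
  nlinarith [Real.pi_gt_three, (Nat.cast_nonneg i : (0 : ℝ) ≤ i)]

lemma sin_lam (i : ℕ) : Real.sin (lam i) = 0 := by
  unfold lam
  exact_mod_cast Real.sin_nat_mul_pi (i + 1)

lemma lam_injective : Function.Injective lam := by
  intro i j h
  unfold lam at h
  have := mul_right_cancel₀ Real.pi_ne_zero h
  exact_mod_cast add_right_cancel this

lemma continuous_sineFun (i : ℕ) : Continuous fun x => √2 * Real.sin (lam i * x) := by fun_prop

/-- The element `ε_{i+1}` of `L²(D)`. -/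
def eps (i : ℕ) : L2D := ofCont _ (continuous_sineFun i).continuousOn

lemma sineCoeff_eq_inner (v : L2D) (i : ℕ) : sineCoeff v i = inner ℝ v (eps i) := by
  rw [eps, inner_ofCont, sineCoeff]

lemma ofCont_const_mul (c : ℝ) {u : ℝ → ℝ} (hu : ContinuousOn u (Icc 0 1)) :
    ofCont (fun x => c * u x) (continuousOn_const.mul hu) = c • ofCont u hu := by
  refine Lp.ext ?_
  filter_upwards [coeFn_ofCont u hu, coeFn_ofCont (fun x => c * u x) (continuousOn_const.mul hu),
    Lp.coeFn_smul c (ofCont u hu)] with x h1 h2 h3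
  rw [h2, h3, Pi.smul_apply, h1, smul_eq_mul]

lemma G_eps (i : ℕ) : G (eps i) = -(lam i ^ 2)⁻¹ • eps i := by
  have hne := (lam_pos i).ne'
  have hs : ∀ x, HasDerivAt (fun x => √2 * Real.sin (lam i * x))
      (lam i * (√2 * Real.cos (lam i * x))) x := fun x => by
    have := (((hasDerivAt_id x).const_mul (lam i)).sin).const_mul (√2)
    simp only [id] at this
    exact this.congr_deriv (by ring)
  have hc : ∀ x, HasDerivAt (fun x => √2 * Real.cos (lam i * x))
      (-lam i * (√2 * Real.sin (lam i * x))) x := fun x => by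
    have := (((hasDerivAt_id x).const_mul (lam i)).cos).const_mul (√2)
    simp only [id] at this
    exact this.congr_deriv (by ring)
  have hcc : Continuous fun x => √2 * Real.cos (lam i * x) := by fun_prop
  have h1 := K_ofCont_deriv hs (continuous_const.mul hcc)
  have h2 := K_ofCont_deriv hc (continuous_const.mul (continuous_sineFun i))
  rw [ofCont_const_mul _ hcc.continuousOn] at h1
  rw [ofCont_const_mul _ (continuous_sineFun i).continuousOn] at h2
  set c := ofCont _ hcc.continuousOn with hcdef
  change K (lam i • c) = eps i - _ • one at h1
  change K (-lam i • eps i) = c - _ • one at h2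
  simp only [mul_zero, Real.sin_zero, Real.cos_zero, zero_smul, sub_zero, mul_one, map_smul]
    at h1 h2
  have h3 : inner ℝ c one = 0 := by
    have e := prim_one_eq c
    have : prim c 1 = (lam i)⁻¹ * ((√2 * Real.sin (lam i * 1)) - √2 * Real.sin (lam i * 0)) := by
      rw [prim_congr (coeFn_ofCont _ hcc.continuousOn) (by simp), prim,
        ← intervalIntegral.integral_eq_sub_of_hasDerivAt (fun y _ => hs y)
          ((continuous_const.mul hcc).intervalIntegrable _ _),
        intervalIntegral.integral_const_mul (lam i), inv_mul_cancel_left₀ hne]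
    rw [← e, this, mul_one, sin_lam]
    simp
  have h4 : K (eps i) = (-(lam i)⁻¹) • (c - √2 • one) := by
    rw [← h2, smul_smul]
    field_simp
    simp
  have h5 : K c = (lam i)⁻¹ • eps i := by rw [← h1, smul_smul, inv_mul_cancel₀ hne, one_smul]
  rw [G_apply, h4, map_smul, map_sub, map_smul, h5, inner_smul_left, inner_sub_left, h3,
    inner_smul_left, real_inner_self_eq_norm_sq, norm_one_L2D]
  simp only [conj_trivial]
  module

lemma norm_eps (i : ℕ) : ‖eps i‖ = 1 := by
  have h : ‖eps i‖ ^ 2 = 1 := by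
    have hne := (lam_pos i).ne'
    rw [← real_inner_self_eq_norm_sq]
    conv_lhs => arg 3; rw [eps]
    rw [inner_ofCont, integral_congr_ae (g := fun x => 2 * Real.sin (lam i * x) ^ 2)]
    · rw [integral_D_eq_intervalIntegral, intervalIntegral.integral_const_mul,
        intervalIntegral.integral_comp_mul_left (fun x => Real.sin x ^ 2) hne, integral_sin_sq]
      simp only [mul_zero, mul_one, Real.sin_zero, zero_mul, sin_lam, smul_eq_mul]
      field_simp
      ring
    · filter_upwards [coeFn_ofCont _ (continuous_sineFun i).continuousOn] with x hx
      rw [eps, hx]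
      nlinarith [Real.mul_self_sqrt (show (0 : ℝ) ≤ 2 by norm_num)]
  nlinarith [norm_nonneg (eps i)]

/-- These are eigenvectors of the symmetric operator `G` with distinct eigenvalues. -/
lemma orthonormal_eps : Orthonormal ℝ eps := by
  refine ⟨norm_eps, fun i j hij => ?_⟩
  have h := inner_G_comm (eps i) (eps j)
  rw [G_eps, G_eps, real_inner_smul_left, real_inner_smul_right] at h
  have hlt : lam i ^ 2 ≠ lam j ^ 2 := fun he => hij
    (lam_injective ((pow_left_inj₀ (lam_pos i).le (lam_pos j).le two_ne_zero).1 he))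
  have hi := pow_pos (lam_pos i) 2
  have hj := pow_pos (lam_pos j) 2
  by_contra hne
  exact hlt (inv_injective (neg_injective (mul_right_cancel₀ hne h)))

/-- The product formula for `cos(πx) sin((k+1)πx)` trades one power of the cosine for the
neighbouring frequencies `k` and `k + 2`, hence the induction for all `k` at once. The case `k = 1`
gives orthogonality to `sin(πx) p(cos(πx))` for every polynomial `p`. -/
lemma integral_cos_pow_mul_sin_eq_zero {f : L2D} (hf : ∀ i, inner ℝ f (eps i) = 0) (n : ℕ) :
    ∀ k : ℕ, ∫ x in D, f x * (Real.cos (Real.pi * x) ^ n * Real.sin (k * Real.pi * x)) = 0 := by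
  have hint : ∀ u : ℝ → ℝ, Continuous u → Integrable (fun x => f x * u x) volD := fun u hu =>
    (memLp_coe f).integrable_mul (memLp_of_continuousOn hu.continuousOn)
  induction n with
  | zero =>
    intro k
    rcases k with _ | k
    · simp
    · have h := hf k
      rw [eps, inner_ofCont] at h
      have e : ∀ x, f x * (√2 * Real.sin (lam k * x)) = √2 * (f x * (Real.cos (Real.pi * x) ^ 0 *
          Real.sin ((k + 1 : ℕ) * Real.pi * x))) := fun x => by
        rw [lam]; push_cast; ring
      simp only [e] at h
      rw [integral_const_mul] at h
      exact (mul_eq_zero.1 h).resolve_left (by positivity)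
  | succ n ih =>
    intro k
    rcases k with _ | k
    · simp
    · have e : ∀ x, f x * (Real.cos (Real.pi * x) ^ (n + 1) *
          Real.sin ((k + 1 : ℕ) * Real.pi * x)) =
          2⁻¹ * (f x * (Real.cos (Real.pi * x) ^ n * Real.sin ((k + 2 : ℕ) * Real.pi * x)) +
            f x * (Real.cos (Real.pi * x) ^ n * Real.sin ((k : ℕ) * Real.pi * x))) := fun x => by
        have h1 : ((k + 2 : ℕ) : ℝ) * Real.pi * x =
          ((k + 1 : ℕ) : ℝ) * Real.pi * x + Real.pi * x := by push_cast; ring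
        have h2 : (k : ℝ) * Real.pi * x =
          ((k + 1 : ℕ) : ℝ) * Real.pi * x - Real.pi * x := by push_cast; ring
        rw [h1, h2, Real.sin_add, Real.sin_sub]
        ring
      simp only [e]
      rw [integral_const_mul, integral_add (hint _ (by fun_prop)) (hint _ (by fun_prop)),
        ih, ih, add_zero, mul_zero]

/-- Completeness by Stone-Weierstrass: `cos(πx)` is injective on `[0,1]`, so its polynomials are
dense in the continuous functions, and `f(x) sin(πx)` annihilates them all. Every test function is
`sin(πx)` times a continuous function. -/
lemma eq_zero_of_forall_inner_eps {f : L2D} (hf : ∀ i, inner ℝ f (eps i) = 0) : f = 0 := by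
  let s : ℝ → ℝ := fun x => Real.sin (Real.pi * x)
  have hs : Continuous s := by fun_prop
  let c : C(Icc (0 : ℝ) 1, ℝ) := ⟨fun x => Real.cos (Real.pi * x), by fun_prop⟩
  have hint : ∀ u : C(Icc (0 : ℝ) 1, ℝ),
      ContinuousOn (fun x => s x * IccExtend zero_le_one u x) (Icc 0 1) := fun u =>
    (hs.mul (u.continuous.Icc_extend' )).continuousOn
  have hmul : ∀ u : ℝ → ℝ, ContinuousOn u (Icc 0 1) → Integrable (fun x => f x * u x) volD :=
    fun u hu => (memLp_coe f).integrable_mul (memLp_of_continuousOn hu)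
  let L : C(Icc (0 : ℝ) 1, ℝ) →ₗ[ℝ] ℝ :=
    { toFun := fun u => ∫ x in D, f x * (s x * IccExtend zero_le_one u x)
      map_add' := fun u v => by
        rw [← integral_add (hmul _ (hint u)) (hmul _ (hint v))]
        refine integral_congr_ae (ae_of_all _ fun x => ?_)
        simp only [IccExtend, Function.comp, ContinuousMap.add_apply]
        ring
      map_smul' := fun a u => by
        rw [RingHom.id_apply, smul_eq_mul, ← integral_const_mul]
        refine integral_congr_ae (ae_of_all _ fun x => ?_)
        simp only [IccExtend, Function.comp, ContinuousMap.smul_apply, smul_eq_mul]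
        ring }
  have hL : Continuous L := by
    refine (L.mkContinuous (∫ x in D, |f x|) fun u => ?_).continuous
    rw [mul_comm, ← integral_const_mul]
    refine norm_integral_le_of_norm_le ((integrable_coe f).abs.const_mul _)
      (ae_of_all _ fun x => ?_)
    rw [norm_mul, norm_mul, Real.norm_eq_abs, Real.norm_eq_abs]
    have h1 : |s x| ≤ 1 := Real.abs_sin_le_one _
    have h2 : ‖IccExtend zero_le_one u x‖ ≤ ‖u‖ := u.norm_coe_le_norm _
    calc |f x| * (|s x| * ‖IccExtend zero_le_one u x‖) ≤ |f x| * (1 * ‖u‖) := by gcongr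
      _ = ‖u‖ * |f x| := by ring
  have hadj : ∀ u ∈ Algebra.adjoin ℝ {c}, L u = 0 := by
    intro u hu
    rw [Algebra.adjoin_singleton_eq_range_aeval] at hu
    obtain ⟨p, rfl⟩ := hu
    induction p using Polynomial.induction_on' with
    | add p q hp hq =>
      simp only [AlgHom.toRingHom_eq_coe, RingHom.coe_coe] at hp hq ⊢
      rw [map_add, map_add, hp, hq, add_zero]
    | monomial n a =>
      simp only [AlgHom.toRingHom_eq_coe, RingHom.coe_coe]
      rw [← mul_one a, ← smul_eq_mul, ← Polynomial.smul_monomial, map_smul, map_smul,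
        Polynomial.aeval_monomial, map_one, one_mul]
      have h := integral_cos_pow_mul_sin_eq_zero hf n 1
      have : L (c ^ n) = 0 := by
        refine Eq.trans ?_ h
        refine setIntegral_congr_fun measurableSet_Ioo fun x hx => ?_
        rw [IccExtend_of_mem _ _ (Ioo_subset_Icc_self hx)]
        simp [s, c, mul_comm]
      rw [this, smul_zero]
  have hsep : (Algebra.adjoin ℝ {c}).SeparatesPoints := by
    intro x y hxy
    refine ⟨c, ⟨c, Algebra.subset_adjoin rfl, rfl⟩, fun h => hxy (Subtype.ext ?_)⟩
    have hp := Real.pi_pos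
    have := Real.injOn_cos (x₁ := Real.pi * x) (x₂ := Real.pi * y)
      ⟨by have := x.2.1; positivity, by nlinarith [x.2.2]⟩
      ⟨by have := y.2.1; positivity, by nlinarith [y.2.2]⟩ h
    exact mul_left_cancel₀ hp.ne' this
  have htop := ContinuousMap.subalgebra_topologicalClosure_eq_top_of_separatesPoints _ hsep
  have hall : ∀ u, L u = 0 := by
    intro u
    have hu : u ∈ (Algebra.adjoin ℝ {c}).topologicalClosure := htop ▸ Algebra.mem_top
    have hcl : IsClosed {u | L u = 0} := isClosed_eq hL continuous_const
    exact closure_minimal (s := (Algebra.adjoin ℝ {c} : Set C(Icc (0 : ℝ) 1, ℝ))) hadj hcl hu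
  refine eq_zero_of_forall_test fun φ hφ => ?_
  have hspos : ∀ x ∈ D, 0 < s x := fun x hx => Real.sin_pos_of_pos_of_lt_pi
    (mul_pos Real.pi_pos hx.1) (by nlinarith [Real.pi_pos, hx.2])
  -- Near a point outside `D`, in particular at the zeros `0` and `1` of the sine, `φ` vanishes
  -- identically.
  have hq : Continuous fun x => φ x / s x := by
    refine continuous_iff_continuousAt.2 fun x => ?_
    by_cases hx : x ∈ D
    · exact hφ.1.continuous.continuousAt.div hs.continuousAt (hspos x hx).ne'
    · have hx' : x ∉ tsupport φ := fun h => hx (hφ.3 h)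
      refine (continuousAt_const (y := (0 : ℝ))).congr ?_
      filter_upwards [(isClosed_tsupport φ).isOpen_compl.mem_nhds hx'] with y hy
      rw [image_eq_zero_of_notMem_tsupport hy, zero_div]
  have h := hall ⟨fun x => φ x / s x, hq.comp continuous_subtype_val⟩
  rw [inner_ofCont, ← h]
  refine setIntegral_congr_fun measurableSet_Ioo fun x hx => ?_
  rw [IccExtend_of_mem _ _ (Ioo_subset_Icc_self hx)]
  have := (hspos x hx).ne'
  simp only [ContinuousMap.coe_mk]
  field_simp

/-- The sine functions form a Hilbert basis of `L²(D)`. -/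
def sineBasis : HilbertBasis ℕ ℝ L2D :=
  HilbertBasis.mkOfOrthogonalEqBot orthonormal_eps (by
    rw [Submodule.eq_bot_iff]
    intro f hf
    refine eq_zero_of_forall_inner_eps fun i => ?_
    rw [Submodule.mem_orthogonal'] at hf
    exact hf _ (Submodule.subset_span ⟨i, rfl⟩))

lemma sineBasis_apply (i : ℕ) : sineBasis i = eps i := by
  rw [sineBasis, HilbertBasis.coe_mkOfOrthogonalEqBot]

lemma hasSum_sineCoeff_mul (f g : L2D) :
    HasSum (fun i => sineCoeff f i * sineCoeff g i) (inner ℝ f g) := by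
  have h := sineBasis.hasSum_inner_mul_inner f g
  simpa only [sineBasis_apply, sineCoeff_eq_inner, real_inner_comm g] using h

lemma hasSum_sineCoeff_sq (f : L2D) : HasSum (fun i => sineCoeff f i ^ 2) (‖f‖ ^ 2) := by
  simpa only [real_inner_self_eq_norm_sq, ← sq] using hasSum_sineCoeff_mul f f

lemma ext_sineCoeff {f g : L2D} (h : ∀ i, sineCoeff f i = sineCoeff g i) : f = g := by
  refine sub_eq_zero.1 (eq_zero_of_forall_inner_eps fun i => ?_)
  rw [inner_sub_left, ← sineCoeff_eq_inner, ← sineCoeff_eq_inner, h, sub_self]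

lemma exists_sineCoeff_eq {a : ℕ → ℝ} (ha : Summable fun i => a i ^ 2) :
    ∃ f : L2D, ∀ i, sineCoeff f i = a i := by
  have hm : Memℓp a 2 := by
    refine memℓp_gen ?_
    simpa using ha
  refine ⟨sineBasis.repr.symm ⟨a, hm⟩, fun i => ?_⟩
  rw [sineCoeff_eq_inner, real_inner_comm, ← sineBasis_apply, ← sineBasis.repr_apply_apply,
    LinearIsometryEquiv.apply_symm_apply]

lemma sineCoeff_add (f g : L2D) (i : ℕ) : sineCoeff (f + g) i = sineCoeff f i + sineCoeff g i := by
  simp only [sineCoeff_eq_inner, inner_add_left]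

lemma sineCoeff_sub (f g : L2D) (i : ℕ) : sineCoeff (f - g) i = sineCoeff f i - sineCoeff g i := by
  simp only [sineCoeff_eq_inner, inner_sub_left]

lemma sineCoeff_smul (c : ℝ) (f : L2D) (i : ℕ) : sineCoeff (c • f) i = c * sineCoeff f i := by
  simp only [sineCoeff_eq_inner, real_inner_smul_left]

lemma sineCoeff_zero (i : ℕ) : sineCoeff 0 i = 0 := by
  simp only [sineCoeff_eq_inner, inner_zero_left]

lemma sineCoeff_G (f : L2D) (i : ℕ) : sineCoeff (G f) i = -(lam i ^ 2)⁻¹ * sineCoeff f i := by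
  rw [sineCoeff_eq_inner, sineCoeff_eq_inner, inner_G_comm, G_eps, real_inner_smul_right]

/-- An element of `Ḣ⁴(D)` is recovered from its fourth weak derivative. -/
lemma eq_G_G_of_hasWeakDeriv {v d : L2D} (hv : v ∈ dotH 4) (h : HasWeakDeriv 4 v d) :
    v = G (G d) := by
  -- Membership in `Ḣ⁴` carries the boundary conditions `v = v'' = 0`; without them `d` would
  -- determine `v` only up to a cubic.
  have hs : Summable fun i => (lam i ^ 4 * sineCoeff v i) ^ 2 := by
    refine Summable.congr hv fun i => ?_
    have : lam i ^ (2 * 4 : ℝ) = lam i ^ 8 := by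
      rw [← Real.rpow_natCast]; norm_num
    rw [this]
    ring
  obtain ⟨f, hf⟩ := exists_sineCoeff_eq hs
  have e : v = G (G f) := ext_sineCoeff fun i => by
    have := (lam_pos i).ne'
    rw [sineCoeff_G, sineCoeff_G, hf]
    field_simp
  rw [e] at h ⊢
  rw [h.unique (hasWeakDeriv_G_G f)]

/-! ### Piecewise polynomials -/

namespace Partition

variable (P : Partition)

lemma node_mem (i : Fin (P.J + 1)) : P.node i ∈ Icc (0 : ℝ) 1 :=
  ⟨P.node_zero ▸ P.strictMono.monotone (Fin.zero_le i),
    P.node_last ▸ P.strictMono.monotone (Fin.le_last i)⟩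

lemma node_lt (j : Fin P.J) : P.node j.castSucc < P.node j.succ :=
  P.strictMono j.castSucc_lt_succ

lemma J_pos : 0 < P.J := by
  by_contra h
  have h0 : Fin.last P.J = 0 := Fin.ext (by simp; omega)
  have := P.node_last
  rw [h0, P.node_zero] at this
  exact zero_ne_one this

lemma le_meshSize (j : Fin P.J) : P.node j.succ - P.node j.castSucc ≤ P.meshSize :=
  le_ciSup (f := fun j : Fin P.J => P.node j.succ - P.node j.castSucc)
    (Set.finite_range _).bddAbove j

lemma meshSize_pos : 0 < P.meshSize :=
  (sub_pos.2 (P.node_lt ⟨0, P.J_pos⟩)).trans_le (P.le_meshSize _)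

/-- The open intervals of the partition lie in `D`. -/
lemma Ioo_subset_D (j : Fin P.J) : Ioo (P.node j.castSucc) (P.node j.succ) ⊆ D :=
  Ioo_subset_Ioo (P.node_mem _).1 (P.node_mem _).2

lemma ae_of_ae_volD {p : ℝ → Prop} (h : ∀ᵐ x ∂volD, p x) (j : Fin P.J) :
    ∀ᵐ x ∂(volume.restrict (Ioo (P.node j.castSucc) (P.node j.succ))), p x :=
  ae_restrict_of_ae_restrict_of_subset (P.Ioo_subset_D j) h

lemma sum_integral_eq {f : ℝ → ℝ} (hf : IntervalIntegrable f volume 0 1) :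
    ∑ j : Fin P.J, ∫ x in (P.node j.castSucc)..(P.node j.succ), f x = ∫ x in (0 : ℝ)..1, f x := by
  let a : ℕ → ℝ := fun k => if h : k < P.J + 1 then P.node ⟨k, h⟩ else 1
  have ha : ∀ k, a k ∈ Icc (0 : ℝ) 1 := fun k => by
    by_cases h : k < P.J + 1
    · simpa only [a, dif_pos h] using P.node_mem _
    · rw [show a k = 1 from dif_neg h]
      simp
  have h := intervalIntegral.sum_integral_adjacent_intervals (a := a) (n := P.J) (f := f)
    (μ := volume) fun k _ => hf.mono_set
      (by rw [uIcc_of_le zero_le_one]; exact uIcc_subset_Icc (ha _) (ha _))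
  have h0 : a 0 = 0 := by simpa [a] using P.node_zero
  have h1 : a P.J = 1 := (dif_pos (Nat.lt_succ_self _)).trans P.node_last
  rw [h0, h1, Finset.sum_range] at h
  rw [← h]
  refine Finset.sum_congr rfl fun j _ => ?_
  have e1 : a j = P.node j.castSucc := by
    have : (j : ℕ) < P.J + 1 := by omega
    simp only [a, dif_pos this]
    rfl
  have e2 : a (j + 1) = P.node j.succ := by
    have : (j : ℕ) + 1 < P.J + 1 := by omega
    simp only [a, dif_pos this]
    rfl
  rw [e1, e2]

end Partition

/-- The space of piecewise polynomials of degree at most `r`. -/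
def piecewisePoly (P : Partition) (r : ℕ) : Submodule ℝ L2D where
  carrier := {v | IsPiecewisePoly P r v}
  add_mem' := by
    intro u v hu hv j
    obtain ⟨p, hp, hup⟩ := hu j
    obtain ⟨q, hq, hvq⟩ := hv j
    refine ⟨p + q, Polynomial.natDegree_add_le_of_degree_le hp hq, ?_⟩
    filter_upwards [hup, hvq, P.ae_of_ae_volD (Lp.coeFn_add u v) j] with x h1 h2 h3
    rw [h3, Pi.add_apply, h1, h2, Polynomial.eval_add]
  zero_mem' := fun j => ⟨0, by simp, by
    filter_upwards [P.ae_of_ae_volD (Lp.coeFn_zero ℝ 2 volD) j] with x h1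
    rw [h1, Pi.zero_apply, Polynomial.eval_zero]⟩
  smul_mem' := by
    intro c u hu j
    obtain ⟨p, hp, hup⟩ := hu j
    refine ⟨c • p, (Polynomial.natDegree_smul_le c p).trans hp, ?_⟩
    filter_upwards [hup, P.ae_of_ae_volD (Lp.coeFn_smul c u) j] with x h1 h2
    rw [h2, Pi.smul_apply, h1, Polynomial.eval_smul]

lemma one_mem_piecewisePoly (P : Partition) (r : ℕ) : one ∈ piecewisePoly P r := fun j =>
  ⟨1, by simp, by
    filter_upwards [P.ae_of_ae_volD coeFn_one j] with x h1
    rw [h1, Polynomial.eval_one]⟩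

lemma exists_antiderivative_polynomial (p : Polynomial ℝ) :
    ∃ q : Polynomial ℝ, q.natDegree ≤ p.natDegree + 1 ∧ Polynomial.derivative q = p := by
  refine ⟨∑ i ∈ Finset.range (p.natDegree + 1),
    Polynomial.monomial (i + 1) (p.coeff i / (i + 1)), ?_, ?_⟩
  · refine Polynomial.natDegree_sum_le_of_forall_le _ _ fun i hi => ?_
    refine (Polynomial.natDegree_monomial_le _).trans ?_
    have := Finset.mem_range.1 hi
    omega
  · conv_rhs => rw [p.as_sum_range]
    rw [Polynomial.derivative_sum]
    refine Finset.sum_congr rfl fun i _ => ?_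
    rw [Polynomial.derivative_monomial, Nat.add_sub_cancel]
    congr 1
    push_cast
    have : (i : ℝ) + 1 ≠ 0 := by positivity
    field_simp

lemma K_mem_piecewisePoly {P : Partition} {r : ℕ} {v : L2D} (hv : v ∈ piecewisePoly P r) :
    K v ∈ piecewisePoly P (r + 1) := by
  intro j
  obtain ⟨p, hp, hvp⟩ := hv j
  obtain ⟨q, hq, hqp⟩ := exists_antiderivative_polynomial p
  set a := P.node j.castSucc with ha
  -- The constant matches the value of the primitive at the left node.
  refine ⟨q + Polynomial.C (prim v a - q.eval a), ?_, ?_⟩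
  · rw [Polynomial.natDegree_add_C]
    omega
  · have hmem : ∀ᵐ x ∂(volume.restrict (Ioo (P.node j.castSucc) (P.node j.succ))),
        x ∈ Ioo (P.node j.castSucc) (P.node j.succ) := ae_restrict_mem measurableSet_Ioo
    filter_upwards [P.ae_of_ae_volD (coeFn_K v) j, hmem] with x h1 hx
    have hxD := Ioo_subset_Icc_self (P.Ioo_subset_D j hx)
    have h2 := prim_sub_prim v (P.node_mem j.castSucc) hxD
    have h3 : ∫ t in a..x, v t = ∫ t in a..x, p.eval t := by
      refine intervalIntegral.integral_congr_ae ?_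
      filter_upwards [(ae_restrict_iff' measurableSet_Ioo).1 hvp] with t ht htx
      rw [uIoc_of_le hx.1.le] at htx
      exact ht ⟨htx.1, htx.2.trans_lt hx.2⟩
    have h4 : ∫ t in a..x, p.eval t = q.eval x - q.eval a :=
      intervalIntegral.integral_eq_sub_of_hasDerivAt
        (fun t _ => by simpa only [hqp] using q.hasDerivAt t)
        (p.continuous.intervalIntegrable _ _)
    rw [h1, Polynomial.eval_add, Polynomial.eval_C]
    linarith

/-- The piecewise constant interpolant of a primitive. -/
lemma exists_piecewiseConst_norm_sub_le (P : Partition) (f : L2D) :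
    ∃ q ∈ piecewisePoly P 0, ‖K f - q‖ ≤ P.meshSize * ‖f‖ := by
  let I : Fin P.J → Set ℝ := fun j => Ioo (P.node j.castSucc) (P.node j.succ)
  let g : ℝ → ℝ := fun x => ∑ j, (I j).indicator (fun _ => prim f (P.node j.castSucc)) x
  have hg : ∀ j, ∀ x ∈ I j, g x = prim f (P.node j.castSucc) := by
    intro j x hx
    refine (Finset.sum_eq_single j (fun i _ hij => ?_) (by simp)).trans
      (indicator_of_mem hx _)
    refine indicator_of_notMem (fun hxi => ?_) _
    rcases lt_or_gt_of_ne hij with h | h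
    · have : P.node i.succ ≤ P.node j.castSucc :=
        P.strictMono.monotone (Fin.succ_le_castSucc_iff.2 h)
      exact absurd (hxi.2.trans_le this) (not_lt.2 hx.1.le)
    · have : P.node j.succ ≤ P.node i.castSucc :=
        P.strictMono.monotone (Fin.succ_le_castSucc_iff.2 h)
      exact absurd (hx.2.trans_le this) (not_lt.2 hxi.1.le)
  have hmem : MemLp g 2 volD := by
    refine memLp_finsetSum _ fun j _ => ?_
    exact memLp_indicator_const 2 measurableSet_Ioo _ (Or.inr (measure_ne_top _ _))
  refine ⟨hmem.toLp g, fun j => ⟨Polynomial.C (prim f (P.node j.castSucc)), by simp, ?_⟩, ?_⟩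
  · have hI : ∀ᵐ x ∂(volume.restrict (I j)), x ∈ I j := ae_restrict_mem measurableSet_Ioo
    filter_upwards [P.ae_of_ae_volD hmem.coeFn_toLp j, hI] with x h1 hx
    rw [h1, hg j x hx, Polynomial.eval_C]
  · refine le_of_sq_le_sq ?_ (mul_nonneg P.meshSize_pos.le (norm_nonneg f))
    have hint : IntervalIntegrable (fun x => (prim f x - g x) ^ 2) volume 0 1 :=
      (intervalIntegrable_iff_integrableOn_Ioo_of_le zero_le_one).2
        ((memLp_of_continuousOn (continuousOn_prim f)).sub hmem).integrable_sq
    have hint2 : IntervalIntegrable (fun x => f x ^ 2) volume 0 1 :=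
      (intervalIntegrable_iff_integrableOn_Ioo_of_le zero_le_one).2 (memLp_coe f).integrable_sq
    have e : ‖K f - hmem.toLp g‖ ^ 2 = ∫ x in (0 : ℝ)..1, (prim f x - g x) ^ 2 := by
      rw [norm_sq_L2D, ← integral_D_eq_intervalIntegral]
      refine integral_congr_ae ?_
      filter_upwards [Lp.coeFn_sub (K f) (hmem.toLp g), coeFn_K f, hmem.coeFn_toLp]
        with x h1 h2 h3
      rw [h1, Pi.sub_apply, h2, h3]
    rw [e, mul_pow, norm_sq_L2D, integral_D_eq_intervalIntegral, ← P.sum_integral_eq hint,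
      ← P.sum_integral_eq hint2, Finset.mul_sum]
    refine Finset.sum_le_sum fun j _ => ?_
    set a := P.node j.castSucc with ha
    set b := P.node j.succ with hb
    have hab : a ≤ b := (P.node_lt j).le
    have ha1 := P.node_mem j.castSucc
    have hb1 := P.node_mem j.succ
    have hsq : IntervalIntegrable (fun x => f x ^ 2) volume a b := hint2.mono_set
      (by rw [uIcc_of_le zero_le_one]; exact uIcc_subset_Icc ha1 hb1)
    have hn : 0 ≤ ∫ t in a..b, f t ^ 2 :=
      intervalIntegral.integral_nonneg hab fun t _ => sq_nonneg _
    -- Cauchy-Schwarz from the left node gives one factor `b - a`; integrating in `x` gives the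
    -- second.
    have hbd : ∀ x ∈ Ioo a b, (prim f x - g x) ^ 2 ≤ (b - a) * ∫ t in a..b, f t ^ 2 := by
      intro x hx
      have hxD := Ioo_subset_Icc_self (P.Ioo_subset_D j hx)
      rw [hg j x hx, prim_sub_prim f ha1 hxD]
      refine (sq_intervalIntegral_le f ha1.1 hx.1.le hxD.2).trans ?_
      have : ∫ t in a..x, f t ^ 2 ≤ ∫ t in a..b, f t ^ 2 :=
        intervalIntegral.integral_mono_interval le_rfl hx.1.le hx.2.le
          (ae_of_all _ fun t => sq_nonneg _) hsq
      have h0 : 0 ≤ ∫ t in a..x, f t ^ 2 :=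
        intervalIntegral.integral_nonneg hx.1.le fun t _ => sq_nonneg _
      have hxb := hx.2.le
      have hax := hx.1.le
      gcongr
    have h1 : ∫ x in a..b, (prim f x - g x) ^ 2 ≤
        ∫ _x in a..b, (b - a) * ∫ t in a..b, f t ^ 2 := by
      refine intervalIntegral.integral_mono_on_of_le_Ioo hab (hint.mono_set ?_) (by simp) hbd
      rw [uIcc_of_le zero_le_one]
      exact uIcc_subset_Icc ha1 hb1
    rw [intervalIntegral.integral_const, smul_eq_mul, ← mul_assoc, ← sq] at h1
    refine h1.trans ?_
    have := P.le_meshSize j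
    have h2 : 0 ≤ b - a := sub_nonneg.2 hab
    gcongr

/-! ### Orthogonal projections onto closures -/

/-- The orthogonal projection onto the closure of `U`. -/
def projCl (U : Submodule ℝ L2D) : L2D →L[ℝ] L2D := U.topologicalClosure.starProjection

lemma projCl_mem (U : Submodule ℝ L2D) (f : L2D) : projCl U f ∈ U.topologicalClosure :=
  Submodule.starProjection_apply_mem _ _

lemma inner_projCl_comm (U : Submodule ℝ L2D) (f g : L2D) :
    inner ℝ (projCl U f) g = inner ℝ f (projCl U g) :=
  Submodule.inner_starProjection_left_eq_right _ _ _

lemma inner_sub_projCl {U : Submodule ℝ L2D} (f : L2D) {u : L2D} (hu : u ∈ U.topologicalClosure) :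
    inner ℝ (f - projCl U f) u = 0 :=
  Submodule.starProjection_inner_eq_zero _ _ hu

lemma projCl_of_mem {U : Submodule ℝ L2D} {u : L2D} (hu : u ∈ U.topologicalClosure) :
    projCl U u = u :=
  Submodule.starProjection_eq_self_iff.2 hu

lemma norm_sub_projCl_le {U : Submodule ℝ L2D} (f : L2D) {u : L2D}
    (hu : u ∈ U.topologicalClosure) : ‖f - projCl U f‖ ≤ ‖f - u‖ := by
  have h1 : inner ℝ (f - projCl U f) (projCl U f - u) = 0 :=
    inner_sub_projCl f (sub_mem (projCl_mem U f) hu)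
  have h2 := norm_add_sq_eq_norm_sq_add_norm_sq_real h1
  rw [sub_add_sub_cancel] at h2
  nlinarith [norm_nonneg (f - projCl U f), norm_nonneg (f - u), norm_nonneg (projCl U f - u)]

/-- Orthogonality to `U` passes to its closure by continuity of the inner product. -/
lemma eq_projCl {U : Submodule ℝ L2D} {f u : L2D} (hu : u ∈ U)
    (h : ∀ χ ∈ U, inner ℝ u χ = inner ℝ f χ) : projCl U f = u := by
  refine Submodule.eq_starProjection_of_mem_of_inner_eq_zero (U.le_topologicalClosure hu)
    fun w hw => ?_
  have hcl : IsClosed {w : L2D | inner ℝ (f - u) w = (0 : ℝ)} :=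
    isClosed_eq (continuous_const.inner continuous_id) continuous_const
  refine closure_minimal (s := (U : Set L2D)) (fun χ hχ => ?_) hcl hw
  rw [mem_ofPred_eq, inner_sub_left, h χ hχ, sub_self]

/-! ### Approximation by piecewise constants -/

lemma norm_K_sub_projCl_le (P : Partition) (f : L2D) :
    ‖K f - projCl (piecewisePoly P 0) (K f)‖ ≤ P.meshSize * ‖f‖ := by
  obtain ⟨q, hq, hle⟩ := exists_piecewiseConst_norm_sub_le P f
  exact (norm_sub_projCl_le _ (Submodule.le_topologicalClosure _ hq)).trans hle

/-- Duality: `f - A f` has mean zero, so `K` moves across the inner product with only a sign change,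
and `‖u‖²` becomes `-(f, K u - A (K u))`. The approximation bound is then applied to `K u`. -/
lemma norm_K_sub_projCl_le' (P : Partition) (f : L2D) :
    ‖K (f - projCl (piecewisePoly P 0) f)‖ ≤ P.meshSize * ‖f‖ := by
  set A := projCl (piecewisePoly P 0)
  set u := K (f - A f) with hu
  have h1 := inner_K_add_inner_K (f - A f) u
  rw [inner_sub_projCl f (Submodule.le_topologicalClosure _ (one_mem_piecewisePoly P 0)),
    zero_mul] at h1
  have h2 : inner ℝ (f - A f) (K u) = inner ℝ f (K u - A (K u)) := by
    rw [inner_sub_left, inner_sub_right, inner_projCl_comm]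
  have h3 : ‖u‖ ^ 2 ≤ ‖f‖ * (P.meshSize * ‖u‖) := by
    rw [← real_inner_self_eq_norm_sq]
    have h4 : inner ℝ u u = -inner ℝ f (K u - A (K u)) := by rw [← h2]; linarith
    rw [h4]
    calc -inner ℝ f (K u - A (K u)) ≤ |inner ℝ f (K u - A (K u))| := neg_le_abs _
      _ ≤ ‖f‖ * ‖K u - A (K u)‖ := abs_real_inner_le_norm _ _
      _ ≤ ‖f‖ * (P.meshSize * ‖u‖) := by
        gcongr
        exact norm_K_sub_projCl_le P u
  rcases (norm_nonneg u).eq_or_lt with h0 | h0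
  · rw [← h0]
    exact mul_nonneg P.meshSize_pos.le (norm_nonneg f)
  · nlinarith

/-! ### Approximation in the finite element space -/

/-- The second derivatives of the elements of `S`. -/
def secondDerivs (S : Submodule ℝ L2D) : Submodule ℝ L2D := S.comap (G : L2D →ₗ[ℝ] L2D)

lemma mem_secondDerivs {S : Submodule ℝ L2D} {f : L2D} : f ∈ secondDerivs S ↔ G f ∈ S := Iff.rfl

lemma G_mem_sobolevZero (f : L2D) : G f ∈ sobolevZero := by
  refine ⟨fun k hk => ?_, prim (K f - inner ℝ (K f) one • one : L2D), continuousOn_prim _, ?_,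
    prim_zero _, ?_⟩
  · interval_cases k
    · exact ⟨_, hasWeakDeriv_zero _⟩
    · exact ⟨_, hasWeakDeriv_G_one f⟩
  · rw [G_eq_K]
    exact coeFn_K _
  · rw [prim_one_eq, inner_sub_left, real_inner_smul_left, real_inner_self_eq_norm_sq,
      norm_one_L2D]
    ring

lemma G_mem_piecewisePoly {P : Partition} {r : ℕ} {v : L2D} (hv : v ∈ piecewisePoly P r) :
    G v ∈ piecewisePoly P (r + 2) := by
  rw [G_eq_K]
  exact K_mem_piecewisePoly (sub_mem (K_mem_piecewisePoly hv)
    (Submodule.smul_mem _ _ (one_mem_piecewisePoly P _)))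

/-- Integrating a piecewise constant twice gives a `C¹` piecewise quadratic. -/
lemma piecewisePoly_le_secondDerivs {P : Partition} {S : Submodule ℝ L2D}
    (hS : IsFESpace P 2 S) : piecewisePoly P 0 ≤ secondDerivs S := by
  intro q hq
  refine hS.full _ (fun k hk => ?_) (G_mem_sobolevZero q) (G_mem_piecewisePoly hq)
  interval_cases k
  · exact ⟨_, hasWeakDeriv_zero _⟩
  · exact ⟨_, hasWeakDeriv_G_one q⟩
  · exact ⟨_, hasWeakDeriv_G q⟩

/-- `K q` is continuous and piecewise linear, so `G (K q)` is a `C²` cubic spline with third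
derivative `q`; it lies in every admissible `S`. -/
lemma map_K_piecewisePoly_le_secondDerivs {P : Partition} {S : Submodule ℝ L2D}
    (hS : IsFESpace P 3 S) : ∀ q ∈ piecewisePoly P 0, K q ∈ secondDerivs S := by
  intro q hq
  refine hS.full _ (fun k hk => ?_) (G_mem_sobolevZero _)
    (G_mem_piecewisePoly (K_mem_piecewisePoly hq))
  interval_cases k
  · exact ⟨_, hasWeakDeriv_zero _⟩
  · exact ⟨_, hasWeakDeriv_G_one _⟩
  · exact ⟨_, hasWeakDeriv_G _⟩
  · exact ⟨_, (hasWeakDeriv_G _).trans (hasWeakDeriv_K q)⟩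

lemma K_mem_closure_secondDerivs {P : Partition} {S : Submodule ℝ L2D} (hS : IsFESpace P 3 S)
    {q : L2D} (hq : q ∈ (piecewisePoly P 0).topologicalClosure) :
    K q ∈ (secondDerivs S).topologicalClosure := by
  have hcl : IsClosed {q : L2D | K q ∈ (secondDerivs S).topologicalClosure} :=
    (secondDerivs S).isClosed_topologicalClosure.preimage K.continuous
  refine closure_minimal (s := (piecewisePoly P 0 : Set L2D)) (fun q hq => ?_) hcl hq
  exact Submodule.le_topologicalClosure _ (map_K_piecewisePoly_le_secondDerivs hS q hq)

/-- First order approximation of functions with one derivative. -/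
lemma norm_K_sub_projCl_secondDerivs_le {P : Partition} {r : ℕ} (hr : r = 2 ∨ r = 3)
    {S : Submodule ℝ L2D} (hS : IsFESpace P r S) (g : L2D) :
    ‖K g - projCl (secondDerivs S) (K g)‖ ≤ P.meshSize * ‖g‖ := by
  rcases hr with rfl | rfl
  · exact (norm_sub_projCl_le _ (Submodule.topologicalClosure_mono
      (piecewisePoly_le_secondDerivs hS) (projCl_mem _ (K g)))).trans (norm_K_sub_projCl_le P g)
  -- For `r = 3` the comparison element is the primitive of the piecewise constant projection of
  -- `g`.
  · refine (norm_sub_projCl_le _ (K_mem_closure_secondDerivs hS (projCl_mem _ g))).trans ?_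
    rw [← map_sub]
    exact norm_K_sub_projCl_le' P g

/-- Approximation, to the order `r - 1`, of functions with two derivatives. -/
lemma norm_G_sub_projCl_secondDerivs_le {P : Partition} {r : ℕ} (hr : r = 2 ∨ r = 3)
    {S : Submodule ℝ L2D} (hS : IsFESpace P r S) (e : L2D) :
    ‖G e - projCl (secondDerivs S) (G e)‖ ≤ 2 * P.meshSize ^ (r - 1) * ‖e‖ := by
  have hP := P.meshSize_pos
  set c := inner ℝ (K e) one with hc
  rw [G_eq_K]
  rcases hr with rfl | rfl
  · refine (norm_K_sub_projCl_secondDerivs_le (Or.inl rfl) hS _).trans ?_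
    have h1 : ‖K e - c • one‖ ≤ ‖e‖ + ‖e‖ := by
      refine (norm_sub_le _ _).trans (add_le_add (norm_K_le e) ?_)
      rw [norm_smul, norm_one_L2D, mul_one]
      refine (norm_inner_le_norm _ _).trans ?_
      rw [norm_one_L2D, mul_one]
      exact norm_K_le e
    calc P.meshSize * ‖K e - c • one‖ ≤ P.meshSize * (‖e‖ + ‖e‖) := by gcongr
      _ = _ := by norm_num; ring
  · set A := projCl (piecewisePoly P 0) with hA
    refine (norm_sub_projCl_le _ (K_mem_closure_secondDerivs hS
      (projCl_mem _ (K e - c • one)))).trans ?_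
    have hone : A one = one :=
      projCl_of_mem (Submodule.le_topologicalClosure _ (one_mem_piecewisePoly P 0))
    -- Subtracting zero in this form lets the duality bound act on `K e - A (K e)`, which is itself
    -- of order `h`; this gives the second power of `h`.
    have h1 : A (K e - A (K e)) = 0 := by
      rw [map_sub, projCl_of_mem (projCl_mem _ (K e)), sub_self]
    have h2 : K (K e - c • one) - K (A (K e - c • one)) =
        K ((K e - A (K e)) - A (K e - A (K e))) := by
      rw [h1, ← map_sub, map_sub A, map_smul A, hone]
      congr 1
      abel
    rw [← hA, h2]
    calc _ ≤ P.meshSize * ‖K e - A (K e)‖ := norm_K_sub_projCl_le' P _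
      _ ≤ P.meshSize * (P.meshSize * ‖e‖) := by
        gcongr
        exact norm_K_sub_projCl_le P e
      _ = P.meshSize ^ 2 * ‖e‖ := by ring
      _ ≤ 2 * P.meshSize ^ 2 * ‖e‖ := by
        rw [mul_assoc]
        exact le_mul_of_one_le_left (by positivity) (by norm_num)

/-- The error of the Ritz projection in `L²(D)`. -/
lemma norm_ritz_error_le {P : Partition} {r : ℕ} (hr : r = 2 ∨ r = 3)
    {S : Submodule ℝ L2D} (hS : IsFESpace P r S) (g : L2D) :
    ‖G (K g - projCl (secondDerivs S) (K g))‖ ≤ 2 * P.meshSize ^ r * ‖g‖ := by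
  have hP := P.meshSize_pos
  set Q := projCl (secondDerivs S)
  set e := G (K g - Q (K g)) with he
  -- Aubin-Nitsche: the error `K g - Q (K g)` is orthogonal to the range of `Q`, so both factors are
  -- approximation errors, of orders `1` and `r - 1`.
  have h1 : inner ℝ e e = inner ℝ (K g - Q (K g)) (G e - Q (G e)) := by
    conv_lhs => arg 2; rw [he]
    rw [inner_G_comm, inner_sub_right, inner_sub_projCl _ (projCl_mem _ _), sub_zero]
  have h2 : ‖e‖ ^ 2 ≤ (P.meshSize * ‖g‖) * (2 * P.meshSize ^ (r - 1) * ‖e‖) := by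
    rw [← real_inner_self_eq_norm_sq, h1]
    refine (real_inner_le_norm _ _).trans ?_
    gcongr
    · exact norm_K_sub_projCl_secondDerivs_le hr hS g
    · exact norm_G_sub_projCl_secondDerivs_le hr hS e
  have h3 : P.meshSize ^ r = P.meshSize * P.meshSize ^ (r - 1) := by
    rcases hr with rfl | rfl
    · norm_num; ring
    · norm_num; ring
  rcases (norm_nonneg e).eq_or_lt with h0 | h0
  · rw [← h0]
    positivity
  · rw [h3]
    refine le_of_mul_le_mul_right ?_ h0
    calc ‖e‖ * ‖e‖ = ‖e‖ ^ 2 := (sq _).symm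
      _ ≤ _ := h2
      _ = _ := by ring

/-! ### Stability of the modified IMEX scheme -/

/-- A discrete Gronwall inequality without restriction on the step size. -/
lemma discrete_stability {T μ dt : ℝ} {M : ℕ} (hdt : 0 < dt) (hT : dt * M = T)
    {α β x : ℕ → ℝ}
    (h1 : (α 1 ^ 2 - α 0 ^ 2) / 2 + dt * β 1 ^ 2 ≤ dt * (x 1 * β 1))
    (hstep : ∀ m, 1 ≤ m → m + 1 ≤ M → (α (m + 1) ^ 2 - α m ^ 2) / 2 + dt * β (m + 1) ^ 2 ≤
      dt * (x (m + 1) * β (m + 1)) + dt * (|μ| * (β m * α (m + 1)))) (hM : 1 ≤ M) :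
    dt * ∑ m ∈ Finset.Icc 1 M, β m ^ 2 ≤
      2 * Real.exp (2 * μ ^ 2 * T) * (α 0 ^ 2 + dt * ∑ m ∈ Finset.Icc 1 M, x m ^ 2) := by
  -- With `ρ = 1/u` one has `1 - 2ρμ²dt = ρ`, so absorbing the coupling term costs exactly one
  -- factor `ρ` in front of `α²`. This holds for every `dt`, hence no step restriction.
  set u : ℝ := 1 + 2 * μ ^ 2 * dt with hu
  have hu1 : 1 ≤ u := by
    have : 0 ≤ 2 * μ ^ 2 * dt := by positivity
    linarith
  have hu0 : 0 < u := by linarith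
  set ρ : ℝ := u⁻¹ with hρ
  have hρ0 : 0 < ρ := inv_pos.2 hu0
  have hρ1 : ρ ≤ 1 := inv_le_one_of_one_le₀ hu1
  have hρu : ρ * u = 1 := inv_mul_cancel₀ hu0.ne'
  have hpow : ∀ n, ρ ^ n ≤ 1 := fun n => pow_le_one₀ hρ0.le hρ1
  -- The separate term `ρ^n dt β_n²/4` is a reserve: it absorbs the explicit term `β_n α_{n+1}` of
  -- the next step. Half of `dt β²` pays for the residual; the other half is split between the sum
  -- and the new reserve.
  have hclaim : ∀ n, 1 ≤ n → n ≤ M →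
      ρ ^ (n + 1) * α n ^ 2 / 2 + ρ ^ n * dt * β n ^ 2 / 4 +
        ∑ m ∈ Finset.Icc 1 n, ρ ^ m * dt * β m ^ 2 / 4 ≤
      α 0 ^ 2 / 2 + ∑ m ∈ Finset.Icc 1 n, dt * x m ^ 2 / 2 := by
    intro n hn
    induction n, hn using Nat.le_induction with
    | base =>
      intro _
      simp only [Finset.Icc_self, Finset.sum_singleton, pow_one]
      have e1 : α 1 ^ 2 / 2 + dt * β 1 ^ 2 / 2 ≤ α 0 ^ 2 / 2 + dt * x 1 ^ 2 / 2 := by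
        nlinarith [mul_nonneg hdt.le (sq_nonneg (x 1 - β 1))]
      have e2 : ρ ^ (1 + 1) * α 1 ^ 2 / 2 ≤ α 1 ^ 2 / 2 := by
        gcongr
        exact mul_le_of_le_one_left (sq_nonneg _) (hpow _)
      have e3 : ρ * dt * β 1 ^ 2 / 4 ≤ dt * β 1 ^ 2 / 4 := by
        rw [mul_assoc, mul_div_assoc]
        exact mul_le_of_le_one_left (by positivity) hρ1
      linarith
    | succ n hn ih =>
      intro hnM
      have ih := ih (by omega)
      rw [Finset.sum_Icc_succ_top (by omega), Finset.sum_Icc_succ_top (by omega)]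
      have hs := hstep n hn hnM
      set a := α (n + 1)
      set b := β (n + 1)
      set y := x (n + 1)
      have k1 : |μ| * (β n * a) ≤ u * β n ^ 2 / 4 + ρ * μ ^ 2 * a ^ 2 := by
        have h0 : 0 ≤ ρ * (u * β n / 2 - |μ| * a) ^ 2 := by positivity
        have h2 : ρ * (u * β n / 2 - |μ| * a) ^ 2 =
            (ρ * u) * (u * β n ^ 2 / 4) - (ρ * u) * (|μ| * (β n * a)) + ρ * |μ| ^ 2 * a ^ 2 := by
          ring
        rw [h2, hρu, sq_abs] at h0
        linarith
      have k2 : y * b ≤ y ^ 2 / 2 + b ^ 2 / 2 := by nlinarith [sq_nonneg (y - b)]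
      have k3 : 1 - 2 * ρ * μ ^ 2 * dt = ρ := by
        have : ρ * (1 + 2 * μ ^ 2 * dt) = 1 := hρu
        linarith
      have k4 : ρ * a ^ 2 / 2 + dt * b ^ 2 / 2 ≤
          α n ^ 2 / 2 + dt * (u * β n ^ 2 / 4) + dt * (y ^ 2 / 2) := by
        have m1 := mul_le_mul_of_nonneg_left k1 hdt.le
        have m2 := mul_le_mul_of_nonneg_left k2 hdt.le
        have e : ρ * a ^ 2 / 2 = a ^ 2 / 2 - dt * (ρ * μ ^ 2 * a ^ 2) := by
          conv_lhs => rw [← k3]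
          ring
        rw [e]
        linarith
      have k5 := mul_le_mul_of_nonneg_left k4 (pow_pos hρ0 (n + 1)).le
      have e1 : ρ ^ (n + 1) * (dt * (u * β n ^ 2 / 4)) = ρ ^ n * dt * β n ^ 2 / 4 := by
        rw [pow_succ]
        linear_combination (ρ ^ n * dt * β n ^ 2 / 4) * hρu
      have e2 : ρ ^ (n + 1) * (dt * (y ^ 2 / 2)) ≤ dt * y ^ 2 / 2 := by
        have := mul_le_of_le_one_left (show 0 ≤ dt * (y ^ 2 / 2) by positivity) (hpow (n + 1))
        linarith
      have e3 : ρ ^ (n + 1 + 1) * a ^ 2 / 2 = ρ ^ (n + 1) * (ρ * a ^ 2 / 2) := by ring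
      have k6 : ρ ^ (n + 1) * (ρ * a ^ 2 / 2 + dt * b ^ 2 / 2) ≤ ρ ^ (n + 1) * (α n ^ 2 / 2) +
          ρ ^ n * dt * β n ^ 2 / 4 + dt * y ^ 2 / 2 := by
        rw [mul_add _ (α n ^ 2 / 2 + _), mul_add _ (α n ^ 2 / 2), e1] at k5
        linarith
      rw [e3]
      nlinarith
  have hM' := hclaim M hM le_rfl
  have hA : ρ ^ M * (dt * ∑ m ∈ Finset.Icc 1 M, β m ^ 2) / 4 ≤
      ∑ m ∈ Finset.Icc 1 M, ρ ^ m * dt * β m ^ 2 / 4 := by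
    rw [Finset.mul_sum, Finset.mul_sum, Finset.sum_div]
    refine Finset.sum_le_sum fun m hm => ?_
    have : ρ ^ M ≤ ρ ^ m := pow_le_pow_of_le_one hρ0.le hρ1 (Finset.mem_Icc.1 hm).2
    rw [mul_assoc (ρ ^ m)]
    gcongr
  have hB : ρ ^ M * (dt * ∑ m ∈ Finset.Icc 1 M, β m ^ 2) ≤
      2 * (α 0 ^ 2 + dt * ∑ m ∈ Finset.Icc 1 M, x m ^ 2) := by
    have e : ∑ m ∈ Finset.Icc 1 M, dt * x m ^ 2 / 2 =
        dt * (∑ m ∈ Finset.Icc 1 M, x m ^ 2) / 2 := by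
      rw [Finset.mul_sum, Finset.sum_div]
    have p1 : 0 ≤ ρ ^ (M + 1) * α M ^ 2 / 2 := by positivity
    have p2 : 0 ≤ ρ ^ M * dt * β M ^ 2 / 4 := by positivity
    rw [e] at hM'
    linarith
  have hC : u ^ M ≤ Real.exp (2 * μ ^ 2 * T) := by
    have h := Real.add_one_le_exp (2 * μ ^ 2 * dt)
    calc u ^ M ≤ Real.exp (2 * μ ^ 2 * dt) ^ M := by
          refine pow_le_pow_left₀ hu0.le ?_ M
          linarith
      _ = Real.exp (2 * μ ^ 2 * T) := by
          rw [← Real.exp_nat_mul, ← hT]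
          congr 1
          ring
  have hR : 0 ≤ 2 * (α 0 ^ 2 + dt * ∑ m ∈ Finset.Icc 1 M, x m ^ 2) := by
    have : 0 ≤ ∑ m ∈ Finset.Icc 1 M, x m ^ 2 := Finset.sum_nonneg fun _ _ => sq_nonneg _
    positivity
  have hρM : u ^ M * ρ ^ M = 1 := by rw [← mul_pow, mul_comm, hρu, one_pow]
  calc dt * ∑ m ∈ Finset.Icc 1 M, β m ^ 2
      = u ^ M * (ρ ^ M * (dt * ∑ m ∈ Finset.Icc 1 M, β m ^ 2)) := by
        rw [← mul_assoc, hρM, one_mul]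
    _ ≤ u ^ M * (2 * (α 0 ^ 2 + dt * ∑ m ∈ Finset.Icc 1 M, x m ^ 2)) := by gcongr
    _ ≤ Real.exp (2 * μ ^ 2 * T) * (2 * (α 0 ^ 2 + dt * ∑ m ∈ Finset.Icc 1 M, x m ^ 2)) := by
        gcongr
    _ = _ := by ring

/-- A bounded operator that is an orthogonal projection. -/
structure IsOrthProj (Q : L2D →L[ℝ] L2D) : Prop where
  symm : ∀ f g, inner ℝ (Q f) g = inner ℝ f (Q g)
  idem : ∀ f, Q (Q f) = Q f

lemma isOrthProj_id : IsOrthProj (.id ℝ L2D) := ⟨fun _ _ => rfl, fun _ => rfl⟩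

lemma isOrthProj_projCl (U : Submodule ℝ L2D) : IsOrthProj (projCl U) :=
  ⟨inner_projCl_comm U, fun f => projCl_of_mem (projCl_mem U f)⟩

namespace IsOrthProj

variable {Q : L2D →L[ℝ] L2D} (hQ : IsOrthProj Q)
include hQ

lemma inner_left (f g : L2D) : inner ℝ (Q f) g = inner ℝ (Q f) (Q g) := by
  rw [← hQ.symm, hQ.idem]

lemma norm_le (f : L2D) : ‖Q f‖ ≤ ‖f‖ := by
  have h : ‖Q f‖ ^ 2 ≤ ‖f‖ * ‖Q f‖ := by
    rw [← real_inner_self_eq_norm_sq, ← hQ.inner_left, real_inner_comm]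
    exact real_inner_le_norm _ _
  nlinarith [norm_nonneg f, norm_nonneg (Q f)]

lemma inner_GQG (f g : L2D) : inner ℝ (G (Q (G f))) g = inner ℝ (Q (G f)) (Q (G g)) := by
  rw [inner_G_comm, hQ.inner_left]

end IsOrthProj

/-- The modified IMEX scheme with the biharmonic operator inverted, started at `x₀`, with
residuals `ξ`. The operator `Q` is the identity for the scheme that is discrete in time only, and
the projection onto the second derivatives of the finite element functions for the fully
discrete one. -/
structure IsScheme (Q : L2D →L[ℝ] L2D) (μ dt : ℝ) (M : ℕ) (x₀ : L2D) (X ξ : ℕ → L2D) : Prop where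
  first : G (Q (G (X 1 - x₀))) + dt • X 1 = dt • ξ 1
  step : ∀ m, 1 ≤ m → m + 1 ≤ M →
    G (Q (G (X (m + 1) - X m))) + dt • (X (m + 1) + μ • G (Q (X m))) = dt • ξ (m + 1)

lemma IsScheme.sub {Q : L2D →L[ℝ] L2D} {μ dt : ℝ} {M : ℕ} {x₀ y₀ : L2D} {X Y ξ η : ℕ → L2D}
    (hX : IsScheme Q μ dt M x₀ X ξ) (hY : IsScheme Q μ dt M y₀ Y η) :
    IsScheme Q μ dt M (x₀ - y₀) (fun m => X m - Y m) (fun m => ξ m - η m) where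
  first := by
    rw [smul_sub dt (ξ 1), ← hX.first, ← hY.first]
    simp only [map_sub]
    module
  step m h1 h2 := by
    rw [smul_sub dt (ξ (m + 1)), ← hX.step m h1 h2, ← hY.step m h1 h2]
    simp only [map_sub]
    module

/-- The stability estimate for the modified IMEX scheme. -/
lemma IsScheme.stability {Q : L2D →L[ℝ] L2D} (hQ : IsOrthProj Q) {T μ dt : ℝ} {M : ℕ}
    (hdt : 0 < dt) (hT : dt * M = T) (hM : 1 ≤ M) {x₀ : L2D} {X ξ : ℕ → L2D}
    (hX : IsScheme Q μ dt M x₀ X ξ) :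
    dt * ∑ m ∈ Finset.Icc 1 M, ‖X m‖ ^ 2 ≤ 2 * Real.exp (2 * μ ^ 2 * T) *
      (‖Q (G x₀)‖ ^ 2 + dt * ∑ m ∈ Finset.Icc 1 M, ‖ξ m‖ ^ 2) := by
  -- The polarisation identity with the term `‖p - q‖²/2` dropped.
  have hpol : ∀ p q : L2D, (‖p‖ ^ 2 - ‖q‖ ^ 2) / 2 ≤ inner ℝ (p - q) p := fun p q => by
    rw [inner_sub_left, real_inner_self_eq_norm_sq]
    have := norm_sub_sq_real q p
    nlinarith [sq_nonneg ‖q - p‖]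
  -- `IsScheme` says nothing about `X 0`; the initial value is the separate parameter `x₀`.
  have key := discrete_stability (α := fun m => ‖Q (G (if m = 0 then x₀ else X m))‖)
    (β := fun m => ‖X m‖) (x := fun m => ‖ξ m‖) (μ := μ) hdt hT ?_ ?_ hM
  · simpa using key
  · have h := congrArg (fun v => inner ℝ v (X 1)) hX.first
    simp only [inner_add_left, real_inner_smul_left, real_inner_self_eq_norm_sq, hQ.inner_GQG]
      at h
    have h1 := hpol (Q (G (X 1))) (Q (G x₀))
    rw [← map_sub, ← map_sub] at h1
    have h2 := mul_le_mul_of_nonneg_left (real_inner_le_norm (ξ 1) (X 1)) hdt.le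
    simp only [one_ne_zero, if_false, if_true]
    linarith
  · intro m hm1 hm2
    have h := congrArg (fun v => inner ℝ v (X (m + 1))) (hX.step m hm1 hm2)
    simp only [inner_add_left, real_inner_smul_left, real_inner_self_eq_norm_sq, hQ.inner_GQG]
      at h
    have h1 := hpol (Q (G (X (m + 1)))) (Q (G (X m)))
    rw [← map_sub, ← map_sub] at h1
    have h2 := mul_le_mul_of_nonneg_left (real_inner_le_norm (ξ (m + 1)) (X (m + 1))) hdt.le
    -- Moving `G` and `Q` onto the new iterate leaves the old one undifferentiated, so the explicit
    -- term has the form `β_m α_{m+1}`.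
    have h3 : -(μ * inner ℝ (G (Q (X m))) (X (m + 1))) ≤
        |μ| * (‖X m‖ * ‖Q (G (X (m + 1)))‖) := by
      rw [inner_G_comm, hQ.symm]
      refine (neg_le_abs _).trans ?_
      rw [abs_mul]
      gcongr
      exact abs_real_inner_le_norm _ _
    have h4 := mul_le_mul_of_nonneg_left h3 hdt.le
    have hm0 : m ≠ 0 := by omega
    simp only [hm0, if_false, Nat.add_eq_zero_iff, one_ne_zero, and_false]
    linarith

/-! ### Solvability of the scheme -/

/-- Lax-Milgram: `A + dt` is coercive with constant `dt`. -/
lemma exists_add_smul_eq {A : L2D →L[ℝ] L2D} (hA : ∀ v, 0 ≤ inner ℝ (A v) v) {dt : ℝ}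
    (hdt : 0 < dt) (f : L2D) : ∃ x, A x + dt • x = f := by
  let S : L2D →L[ℝ] L2D := A + dt • .id ℝ L2D
  let B : L2D →L[ℝ] L2D →L[ℝ] ℝ := LinearMap.mkContinuous₂
    (LinearMap.mk₂ ℝ (fun v w => inner ℝ (S v) w)
      (fun u v w => by rw [map_add, inner_add_left])
      (fun c v w => by rw [map_smul, real_inner_smul_left, smul_eq_mul])
      (fun u v w => inner_add_right _ _ _)
      (fun c v w => by rw [real_inner_smul_right, smul_eq_mul])) ‖S‖
    (fun v w => (norm_inner_le_norm _ _).trans (mul_le_mul_of_nonneg_right (S.le_opNorm v) (norm_nonneg w)))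
  have hB : ∀ v w, B v w = inner ℝ (S v) w := fun _ _ => rfl
  have hS : ∀ v, S v = A v + dt • v := fun _ => rfl
  have hco : IsCoercive B := ⟨dt, hdt, fun v => by
    rw [hB, hS, inner_add_left, real_inner_smul_left, real_inner_self_eq_norm_mul_norm,
      mul_assoc]
    linarith [hA v]⟩
  refine ⟨hco.continuousLinearEquivOfBilin.symm f, ?_⟩
  set x := hco.continuousLinearEquivOfBilin.symm f with hx
  rw [← hS]
  refine ext_inner_right ℝ fun w => ?_
  rw [← hB, ← hco.continuousLinearEquivOfBilin_apply, hx, ContinuousLinearEquiv.apply_symm_apply]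

/-- The interpolation between rough and smooth data needs solutions started from a truncated initial
value, which are not among the given data. -/
lemma exists_isScheme {Q : L2D →L[ℝ] L2D} (hQ : IsOrthProj Q) (μ : ℝ) {dt : ℝ} (hdt : 0 < dt)
    (M : ℕ) (x₀ : L2D) : ∃ X, IsScheme Q μ dt M x₀ X 0 := by
  let A : L2D →L[ℝ] L2D := G ∘L Q ∘L G
  have hA : ∀ v, 0 ≤ inner ℝ (A v) v := fun v => by
    change 0 ≤ inner ℝ (G (Q (G v))) v
    rw [hQ.inner_GQG]
    exact real_inner_self_nonneg
  choose sol hsol using fun f => exists_add_smul_eq hA hdt f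
  let X : ℕ → L2D := fun n => Nat.rec x₀ (fun m x =>
    sol (if m = 0 then A x else A x - (dt * μ) • G (Q x))) n
  have h1 : X 1 = sol (A x₀) := rfl
  have hm : ∀ m, 1 ≤ m → X (m + 1) = sol (A (X m) - (dt * μ) • G (Q (X m))) := fun m hm => by
    change sol (if m = 0 then A (X m) else A (X m) - (dt * μ) • G (Q (X m))) = _
    rw [if_neg (by omega)]
  refine ⟨X, ⟨?_, fun m hm1 _ => ?_⟩⟩
  · have h := hsol (A x₀)
    rw [← h1] at h
    change A (X 1 - x₀) + _ = _
    rw [map_sub, Pi.zero_apply, smul_zero, sub_add_eq_add_sub, h, sub_self]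
  · have h := hsol (A (X m) - (dt * μ) • G (Q (X m)))
    rw [← hm m hm1] at h
    change A (X (m + 1) - X m) + _ = _
    rw [map_sub, Pi.zero_apply, smul_zero, smul_add, smul_smul]
    calc _ = (A (X (m + 1)) + dt • X (m + 1)) - A (X m) + (dt * μ) • G (Q (X m)) := by abel
      _ = 0 := by rw [h]; abel

/-! ### The two schemes in inverted form -/

lemma IsTimeDiscrete.isScheme {μ dt : ℝ} {M : ℕ} (hM : 1 ≤ M) {w₀ : L2D} {W : ℕ → L2D}
    (h : IsTimeDiscrete μ dt M w₀ W) : IsScheme (.id ℝ L2D) μ dt M w₀ W 0 where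
  first := by
    obtain ⟨d₄, h4, he⟩ := h.first
    have h1 := eq_G_G_of_hasWeakDeriv (h.mem 1 le_rfl hM) h4
    have h2 := congrArg (fun v => G (G v)) he
    simp only [map_add, map_smul, ← h1, map_zero, h.init] at h2
    simpa using h2
  step m hm1 hm2 := by
    obtain ⟨d₄, d₂, h4, h2, he⟩ := h.step (m + 1) (by omega) hm2
    rw [Nat.add_sub_cancel] at h2 he
    have e1 := eq_G_G_of_hasWeakDeriv (h.mem (m + 1) (by omega) hm2) h4
    obtain ⟨d, hd⟩ : ∃ d, W m = G (G d) := by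
      rcases hm1.eq_or_lt with rfl | hlt
      · obtain ⟨d, hd, -⟩ := h.first
        exact ⟨d, eq_G_G_of_hasWeakDeriv (h.mem 1 le_rfl (by omega)) hd⟩
      · obtain ⟨d, -, hd, -⟩ := h.step m hlt (by omega)
        exact ⟨d, eq_G_G_of_hasWeakDeriv (h.mem m hm1 (by omega)) hd⟩
    have e2 : G d₂ = W m := by
      rw [hd] at h2 ⊢
      rw [h2.unique (hasWeakDeriv_G (G d))]
    have e3 := congrArg (fun v => G (G v)) he
    simp only [map_add, map_smul, ← e1, map_zero, e2] at e3
    simpa using e3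

lemma projCl_congr {U : Submodule ℝ L2D} {f g : L2D}
    (h : ∀ χ ∈ U, inner ℝ f χ = inner ℝ g χ) : projCl U f = projCl U g := by
  rw [← sub_eq_zero, ← map_sub]
  refine eq_projCl U.zero_mem fun χ hχ => ?_
  rw [inner_zero_left, inner_sub_left, h χ hχ, sub_self]

/-- Only inner products with `G χ ∈ S` matter here, so `P_h` is absorbed. -/
lemma projCl_G_of_isL2Proj {S : Submodule ℝ L2D} {f p : L2D} (h : IsL2Proj S f p) :
    projCl (secondDerivs S) (G p) = projCl (secondDerivs S) (G f) :=
  projCl_congr fun χ hχ => by rw [inner_G_comm, inner_G_comm, h.2 (G χ) hχ]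

/-- For `χ` in `secondDerivs S`, symmetry of `G` and the definition of `B_h` give `(G b, χ) = (b, G
χ) = (φ₂, χ)`; hence the projection of `G b` is `φ₂`. -/
lemma G_projCl_G_of_isDiscreteBiharmonic {P : Partition} {r : ℕ} {S : Submodule ℝ L2D}
    (hS : IsFESpace P r S) {φ b : L2D} (h : IsDiscreteBiharmonic S φ b) :
    G (projCl (secondDerivs S) (G b)) = φ := by
  obtain ⟨hφ, -, φ₂, h2, hb⟩ := h
  have e : φ = G φ₂ := eq_G_of_hasWeakDeriv (hS.conforming φ hφ).1 (hS.conforming φ hφ).2.1 h2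
  have : projCl (secondDerivs S) (G b) = φ₂ :=
    eq_projCl (mem_secondDerivs.2 (e ▸ hφ)) fun χ hχ => by
      rw [inner_G_comm, hb (G χ) hχ χ (hasWeakDeriv_G χ)]
  rw [this, e]

lemma IsFullyDiscrete.isScheme {μ dt : ℝ} {M : ℕ} {P : Partition} {r : ℕ}
    {S : Submodule ℝ L2D} (hS : IsFESpace P r S) {w₀ : L2D} {Wh : ℕ → L2D}
    (h : IsFullyDiscrete μ dt M S w₀ Wh) :
    IsScheme (projCl (secondDerivs S)) μ dt M w₀ Wh 0 where
  first := by
    obtain ⟨b, hb, he⟩ := h.first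
    have e := congrArg (fun v => G (projCl (secondDerivs S) (G v))) he
    simp only [map_add, map_sub, map_smul, map_zero, projCl_G_of_isL2Proj h.init,
      G_projCl_G_of_isDiscreteBiharmonic hS hb] at e
    simpa using e
  step m hm1 hm2 := by
    obtain ⟨b, d₂, p, hb, hd, hp, he⟩ := h.step (m + 1) (by omega) hm2
    rw [Nat.add_sub_cancel] at hd he
    have hmem := hS.conforming _ (h.mem m (by omega))
    have e1 : Wh m = G d₂ := eq_G_of_hasWeakDeriv hmem.1 hmem.2.1 hd
    have e := congrArg (fun v => G (projCl (secondDerivs S) (G v))) he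
    simp only [map_add, map_sub, map_smul, map_zero, projCl_G_of_isL2Proj hp, ← e1,
      G_projCl_G_of_isDiscreteBiharmonic hS hb] at e
    simpa using e

/-! ### Error estimates -/

/-- The consistency error of the semidiscrete solution in the fully discrete scheme. -/
lemma IsScheme.residual {μ dt : ℝ} {M : ℕ} (hM : 1 ≤ M) {x₀ : L2D} {W g : ℕ → L2D}
    (hW : IsScheme (.id ℝ L2D) μ dt M x₀ W 0) (hg : ∀ m, 1 ≤ m → m ≤ M → W m = G (g m))
    (Q : L2D →L[ℝ] L2D) : IsScheme Q μ dt M x₀ W (fun m => G (g m - Q (g m))) where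
  first := by
    have h := hW.first
    rw [ContinuousLinearMap.id_apply, hg 1 le_rfl hM, ← map_smul, ← map_add, Pi.zero_apply,
      smul_zero, ← hg 1 le_rfl hM] at h
    -- Cancelling one `G` expresses `G (W 1 - x₀)` through `g 1`, to which `Q` can then be applied.
    have h1 := eq_neg_of_add_eq_zero_left (G_injective (h.trans (map_zero G).symm))
    rw [h1, map_neg, map_neg, map_smul, map_smul, map_sub, ← hg 1 le_rfl hM]
    module
  step m hm1 hm2 := by
    have h := hW.step m hm1 hm2
    have e := hg (m + 1) (by omega) hm2
    rw [ContinuousLinearMap.id_apply, ContinuousLinearMap.id_apply, Pi.zero_apply, smul_zero]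
      at h
    have h0 : G (G (W (m + 1) - W m) + dt • (g (m + 1) + μ • W m)) = 0 := by
      rw [← h, map_add, map_smul, map_add, map_smul, ← e]
    have h1 := eq_neg_of_add_eq_zero_left (G_injective (h0.trans (map_zero G).symm))
    rw [h1]
    simp only [map_neg, map_smul, map_sub, map_add, ← e]
    module

/-- Solving the recursion for the new iterate shows that it lies in the range of `G ∘ G`. This is
only qualitative, as the preimage carries a factor `1/dt`. -/
lemma IsScheme.exists_eq_G_G {μ dt : ℝ} {M : ℕ} (hdt : 0 < dt) {x₀ : L2D} {W : ℕ → L2D}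
    (hW : IsScheme (.id ℝ L2D) μ dt M x₀ W 0) (m : ℕ) (hm : 1 ≤ m) (hmM : m ≤ M) :
    ∃ f, W m = G (G f) := by
  have hd : ∀ v w : L2D, v + dt • w = 0 → w = -dt⁻¹ • v := fun v w h => by
    rw [eq_neg_of_add_eq_zero_left h, neg_smul, smul_neg, neg_neg, smul_smul,
      inv_mul_cancel₀ hdt.ne', one_smul]
  induction m, hm using Nat.le_induction with
  | base =>
    have h := hW.first
    rw [Pi.zero_apply, smul_zero] at h
    refine ⟨-dt⁻¹ • (W 1 - x₀), ?_⟩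
    rw [map_smul, map_smul]
    exact hd _ _ h
  | succ m hm ih =>
    obtain ⟨f, hf⟩ := ih (by omega)
    have h := hW.step m hm hmM
    rw [Pi.zero_apply, smul_zero] at h
    have h1 := hd _ _ h
    refine ⟨-dt⁻¹ • (W (m + 1) - W m) - μ • G f, ?_⟩
    rw [map_sub, map_sub, map_smul, map_smul, map_smul, map_smul, ← hf, eq_sub_iff_add_eq]
    exact h1

/-- The derivative of `G f`, in terms of the sine coefficients. -/
lemma exists_G_eq_K (f : L2D) : ∃ g, G f = K g ∧
    HasSum (fun i => lam i ^ 6 * sineCoeff (G (G f)) i ^ 2) (‖g‖ ^ 2) := by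
  refine ⟨K f - inner ℝ (K f) one • one, G_eq_K f, ?_⟩
  set g := K f - inner ℝ (K f) one • one with hg
  have h1 : inner ℝ g one = 0 := by
    rw [hg, inner_sub_left, real_inner_smul_left, real_inner_self_eq_norm_sq, norm_one_L2D]
    ring
  have h2 : ‖g‖ ^ 2 = -inner ℝ f (G f) := by
    have h := inner_K_add_inner_K f g
    rw [← G_eq_K, h1, mul_zero] at h
    rw [← real_inner_self_eq_norm_sq]
    conv_lhs => arg 2; rw [hg]
    rw [inner_sub_left, real_inner_smul_left, real_inner_comm g one, h1]
    linarith
  rw [h2]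
  refine (hasSum_sineCoeff_mul f (G f)).neg.congr_fun fun i => ?_
  have := (lam_pos i).ne'
  rw [sineCoeff_G, sineCoeff_G]
  field_simp

/-- Parabolic smoothing for a single Fourier mode. -/
lemma IsScheme.sum_sineCoeff_sq_le {T μ dt : ℝ} {M : ℕ} (hdt : 0 < dt) (hT : dt * M = T)
    (hM : 1 ≤ M) {x₀ : L2D} {W : ℕ → L2D} (hW : IsScheme (.id ℝ L2D) μ dt M x₀ W 0) (i : ℕ) :
    dt * ∑ m ∈ Finset.Icc 1 M, lam i ^ 6 * sineCoeff (W m) i ^ 2 ≤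
      2 * Real.exp (2 * μ ^ 2 * T) * (lam i ^ 2 * sineCoeff x₀ i ^ 2) := by
  have hl := lam_pos i
  set l := (lam i ^ 2)⁻¹ with hl'
  have hl0 : 0 < l := by positivity
  have hw : ∀ v : L2D, |sineCoeff v i| ^ 2 = sineCoeff v i ^ 2 := fun v => sq_abs _
  -- On one mode `G` acts as `-l` with `l = λ⁻²`. The resulting bound has `λ⁻⁴` on the right;
  -- multiplying by `λ⁶` yields the `Ḣ³` and `Ḣ¹` weights.
  have key := discrete_stability (α := fun m => l * |sineCoeff (if m = 0 then x₀ else W m) i|)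
    (β := fun m => |sineCoeff (W m) i|) (x := fun _ => 0) (μ := μ) hdt hT ?_ ?_ hM
  · simp only [if_true, mul_pow, sq_abs, ne_eq, OfNat.ofNat_ne_zero, not_false_eq_true, zero_pow,
      Finset.sum_const_zero, mul_zero, add_zero] at key
    rw [← Finset.mul_sum]
    have h6 : 0 ≤ lam i ^ 6 := by positivity
    have h := mul_le_mul_of_nonneg_left key h6
    have e : lam i ^ 6 * l ^ 2 = lam i ^ 2 := by
      rw [hl']
      field_simp
    calc _ = lam i ^ 6 * (dt * ∑ m ∈ Finset.Icc 1 M, sineCoeff (W m) i ^ 2) := by ring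
      _ ≤ _ := h
      _ = 2 * Real.exp (2 * μ ^ 2 * T) * ((lam i ^ 6 * l ^ 2) * sineCoeff x₀ i ^ 2) := by ring
      _ = _ := by rw [e]
  · have h := congrArg (fun v => sineCoeff v i) hW.first
    simp only [ContinuousLinearMap.id_apply, Pi.zero_apply, smul_zero, sineCoeff_add, sineCoeff_G,
      sineCoeff_smul, sineCoeff_sub, sineCoeff_zero] at h
    simp only [one_ne_zero, if_false, if_true, mul_pow, sq_abs, zero_mul, mul_zero]
    rw [← hl'] at h
    have h' := congrArg (fun t => t * sineCoeff (W 1) i) h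
    nlinarith [sq_nonneg (l * (sineCoeff (W 1) i - sineCoeff x₀ i))]
  · intro m hm1 hm2
    have h := congrArg (fun v => sineCoeff v i) (hW.step m hm1 hm2)
    simp only [ContinuousLinearMap.id_apply, Pi.zero_apply, smul_zero, sineCoeff_add, sineCoeff_G,
      sineCoeff_smul, sineCoeff_sub, sineCoeff_zero] at h
    rw [← hl'] at h
    have hm0 : m ≠ 0 := by omega
    simp only [hm0, if_false, Nat.add_eq_zero_iff, one_ne_zero, and_false, mul_pow, sq_abs,
      zero_mul, mul_zero, zero_add]
    have h' := congrArg (fun t => t * sineCoeff (W (m + 1)) i) h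
    have h3 : μ * (sineCoeff (W m) i * (l * sineCoeff (W (m + 1)) i)) ≤
        |μ| * (|sineCoeff (W m) i| * (l * |sineCoeff (W (m + 1)) i|)) := by
      refine (le_abs_self _).trans_eq ?_
      rw [abs_mul, abs_mul, abs_mul, abs_of_pos hl0]
    have h4 := mul_le_mul_of_nonneg_left h3 hdt.le
    nlinarith [sq_nonneg (l * (sineCoeff (W (m + 1)) i - sineCoeff (W m) i))]

/-- The error estimate for smooth data. -/
lemma error_le_of_smooth {T μ dt : ℝ} {M : ℕ} (hdt : 0 < dt) (hT : dt * M = T)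
    (hM : 1 ≤ M) {P : Partition} {r : ℕ} (hr : r = 2 ∨ r = 3) {S : Submodule ℝ L2D}
    (hS : IsFESpace P r S) {x₀ : L2D} {W Wh : ℕ → L2D}
    (hW : IsScheme (.id ℝ L2D) μ dt M x₀ W 0)
    (hWh : IsScheme (projCl (secondDerivs S)) μ dt M x₀ Wh 0)
    {A : ℝ} (hA : HasSum (fun i => lam i ^ 2 * sineCoeff x₀ i ^ 2) A) :
    dt * ∑ m ∈ Finset.Icc 1 M, ‖W m - Wh m‖ ^ 2 ≤
      (2 * Real.exp (2 * μ ^ 2 * T)) ^ 2 * (4 * P.meshSize ^ (2 * r) * A) := by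
  set c := 2 * Real.exp (2 * μ ^ 2 * T) with hc
  have hP := P.meshSize_pos
  -- Here `g` is the third derivative of `W m`; outside `1, …, M` the value `0` only makes the
  -- choice total.
  have hex : ∀ m, ∃ g : L2D, (1 ≤ m → m ≤ M → W m = G (K g)) ∧ (1 ≤ m → m ≤ M →
      HasSum (fun i => lam i ^ 6 * sineCoeff (W m) i ^ 2) (‖g‖ ^ 2)) := fun m => by
    by_cases hm : 1 ≤ m ∧ m ≤ M
    · obtain ⟨f, hf⟩ := hW.exists_eq_G_G hdt m hm.1 hm.2
      obtain ⟨g, hg, hs⟩ := exists_G_eq_K f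
      exact ⟨g, fun _ _ => by rw [hf, hg], fun _ _ => by rw [hf]; exact hs⟩
    · exact ⟨0, fun h1 h2 => absurd ⟨h1, h2⟩ hm, fun h1 h2 => absurd ⟨h1, h2⟩ hm⟩
  choose g hg hs using hex
  -- The error starts from zero in the fully discrete recursion and is driven only by Ritz
  -- projection errors.
  have hE := (hW.residual hM hg (projCl (secondDerivs S))).sub hWh
  have h1 := hE.stability (isOrthProj_projCl _) hdt hT hM
  simp only [sub_self, map_zero, norm_zero, ne_eq, OfNat.ofNat_ne_zero, not_false_eq_true,
    zero_pow, zero_add, Pi.zero_apply, sub_zero] at h1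
  have h2 : ∑ m ∈ Finset.Icc 1 M, ‖G (K (g m) - projCl (secondDerivs S) (K (g m)))‖ ^ 2 ≤
      4 * P.meshSize ^ (2 * r) * ∑ m ∈ Finset.Icc 1 M, ‖g m‖ ^ 2 := by
    rw [Finset.mul_sum]
    refine Finset.sum_le_sum fun m _ => ?_
    calc _ ≤ (2 * P.meshSize ^ r * ‖g m‖) ^ 2 := by
          gcongr
          exact norm_ritz_error_le hr hS (g m)
      _ = _ := by ring
  have h3 : dt * ∑ m ∈ Finset.Icc 1 M, ‖g m‖ ^ 2 ≤ c * A := by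
    have hsum : HasSum (fun i => dt * ∑ m ∈ Finset.Icc 1 M, lam i ^ 6 * sineCoeff (W m) i ^ 2)
        (dt * ∑ m ∈ Finset.Icc 1 M, ‖g m‖ ^ 2) := by
      refine HasSum.mul_left _ (hasSum_sum fun m hm => ?_)
      exact hs m (Finset.mem_Icc.1 hm).1 (Finset.mem_Icc.1 hm).2
    exact hasSum_le (fun i => hW.sum_sineCoeff_sq_le hdt hT hM i) hsum (hA.mul_left c)
  have hc0 : 0 ≤ c := by positivity
  calc _ ≤ c * (dt * ∑ m ∈ Finset.Icc 1 M,
        ‖G (K (g m) - projCl (secondDerivs S) (K (g m)))‖ ^ 2) := h1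
    _ ≤ c * (dt * (4 * P.meshSize ^ (2 * r) * ∑ m ∈ Finset.Icc 1 M, ‖g m‖ ^ 2)) := by gcongr
    _ = c * (4 * P.meshSize ^ (2 * r) * (dt * ∑ m ∈ Finset.Icc 1 M, ‖g m‖ ^ 2)) := by ring
    _ ≤ c * (4 * P.meshSize ^ (2 * r) * (c * A)) := by gcongr
    _ = _ := by ring

/-- The error estimate for rough data. -/
lemma error_le_of_rough {T μ dt : ℝ} {M : ℕ} (hdt : 0 < dt) (hT : dt * M = T)
    (hM : 1 ≤ M) {Q : L2D →L[ℝ] L2D} (hQ : IsOrthProj Q) {x₀ : L2D} {W Wh : ℕ → L2D}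
    (hW : IsScheme (.id ℝ L2D) μ dt M x₀ W 0) (hWh : IsScheme Q μ dt M x₀ Wh 0) :
    dt * ∑ m ∈ Finset.Icc 1 M, ‖W m - Wh m‖ ^ 2 ≤
      4 * (2 * Real.exp (2 * μ ^ 2 * T)) * ‖G x₀‖ ^ 2 := by
  set c := 2 * Real.exp (2 * μ ^ 2 * T) with hc
  have hc0 : 0 ≤ c := by positivity
  have h1 := hW.stability isOrthProj_id hdt hT hM
  have h2 := hWh.stability hQ hdt hT hM
  simp only [Pi.zero_apply, norm_zero, ne_eq, OfNat.ofNat_ne_zero, not_false_eq_true,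
    zero_pow, Finset.sum_const_zero, mul_zero, add_zero, ContinuousLinearMap.id_apply] at h1 h2
  have h3 : c * ‖Q (G x₀)‖ ^ 2 ≤ c * ‖G x₀‖ ^ 2 := by
    gcongr
    exact hQ.norm_le _
  have h4 : ∑ m ∈ Finset.Icc 1 M, ‖W m - Wh m‖ ^ 2 ≤
      2 * ∑ m ∈ Finset.Icc 1 M, ‖W m‖ ^ 2 + 2 * ∑ m ∈ Finset.Icc 1 M, ‖Wh m‖ ^ 2 := by
    rw [Finset.mul_sum, Finset.mul_sum, ← Finset.sum_add_distrib]
    refine Finset.sum_le_sum fun m _ => ?_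
    have := norm_sub_le (W m) (Wh m)
    nlinarith [sq_nonneg (‖W m‖ - ‖Wh m‖), norm_nonneg (W m - Wh m)]
  have h5 := mul_le_mul_of_nonneg_left h4 hdt.le
  rw [← hc] at h1 h2
  nlinarith

/-- The error estimate interpolated between rough and smooth data. -/
lemma error_sq_le {T μ dt : ℝ} {M : ℕ} (hdt : 0 < dt) (hT : dt * M = T)
    (hM : 1 ≤ M) {P : Partition} {r : ℕ} (hr : r = 2 ∨ r = 3) {S : Submodule ℝ L2D}
    (hS : IsFESpace P r S) {x₀ : L2D} (hx₀ : x₀ ∈ dotH 1) {W Wh : ℕ → L2D}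
    (hW : IsScheme (.id ℝ L2D) μ dt M x₀ W 0)
    (hWh : IsScheme (projCl (secondDerivs S)) μ dt M x₀ Wh 0)
    {θ : ℝ} (hθ0 : 0 ≤ θ) (hθ1 : θ ≤ 1) :
    dt * ∑ m ∈ Finset.Icc 1 M, ‖W m - Wh m‖ ^ 2 ≤
      8 * ((2 * Real.exp (2 * μ ^ 2 * T)) ^ 2 + 2 * Real.exp (2 * μ ^ 2 * T)) *
        (P.meshSize ^ (r * θ)) ^ 2 *
        ∑' i, lam i ^ (2 * (3 * θ - 2)) * sineCoeff x₀ i ^ 2 := by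
  set c := 2 * Real.exp (2 * μ ^ 2 * T) with hc
  set h := P.meshSize with hh
  have hP : 0 < h := P.meshSize_pos
  set w := sineCoeff x₀ with hw
  -- The cut-off frequency balances the two parts: both `h^(2r) N^(6(1-θ))` and `N^(-6θ)` equal
  -- `h^(2rθ)`.
  set N : ℝ := h ^ (-(r : ℝ) / 3) with hN
  have hN0 : 0 < N := Real.rpow_pos_of_pos hP _
  have hsum : Summable fun i => lam i ^ (2 * (3 * θ - 2)) * w i ^ 2 := by
    refine Summable.of_nonneg_of_le (fun i => ?_) (fun i => ?_) hx₀
    · have := lam_pos i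
      positivity
    · exact mul_le_mul_of_nonneg_right
        (Real.rpow_le_rpow_of_exponent_le (one_le_lam i) (by linarith)) (sq_nonneg _)
  set Z := ∑' i, lam i ^ (2 * (3 * θ - 2)) * w i ^ 2 with hZ
  have hZ0 : 0 ≤ Z := tsum_nonneg fun i => by
    have := lam_pos i
    positivity
  -- On the modes kept in `y₀` the `Ḣ¹` weight, on the others the `Ḣ⁻²` weight, is compared with
  -- `Ḣ^(3θ-2)` at the cost of a power of `N`.
  obtain ⟨y₀, hy⟩ : ∃ y₀ : L2D, ∀ i, sineCoeff y₀ i = if lam i ≤ N then w i else 0 := by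
    refine exists_sineCoeff_eq ((hasSum_sineCoeff_sq x₀).summable.of_nonneg_of_le
      (fun i => sq_nonneg _) fun i => ?_)
    split_ifs
    · exact le_rfl
    · simpa using sq_nonneg (sineCoeff x₀ i)
  obtain ⟨Y, hY⟩ := exists_isScheme isOrthProj_id μ hdt M y₀
  obtain ⟨Yh, hYh⟩ := exists_isScheme (isOrthProj_projCl (secondDerivs S)) μ hdt M y₀
  have hlow : ∀ i, lam i ^ 2 * sineCoeff y₀ i ^ 2 ≤
      N ^ (6 * (1 - θ)) * (lam i ^ (2 * (3 * θ - 2)) * w i ^ 2) := fun i => by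
    have hl := lam_pos i
    rw [hy]
    split_ifs with hi
    · have e : lam i ^ 2 = lam i ^ (6 * (1 - θ)) * lam i ^ (2 * (3 * θ - 2)) := by
        rw [← Real.rpow_add hl, ← Real.rpow_natCast]
        congr 1
        push_cast
        ring
      rw [e, mul_assoc]
      gcongr
    · rw [zero_pow two_ne_zero, mul_zero]
      positivity
  have hhigh : ∀ i, sineCoeff (G (x₀ - y₀)) i ^ 2 ≤
      N ^ (-(6 * θ)) * (lam i ^ (2 * (3 * θ - 2)) * w i ^ 2) := fun i => by
    have hl := lam_pos i
    rw [sineCoeff_G, sineCoeff_sub, hy]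
    split_ifs with hi
    · rw [← hw, sub_self, mul_zero, zero_pow two_ne_zero]
      positivity
    · have e : (-(lam i ^ 2)⁻¹) ^ 2 = lam i ^ (-(6 * θ)) * lam i ^ (2 * (3 * θ - 2)) := by
        rw [← Real.rpow_add hl, neg_sq, ← inv_pow, ← pow_mul, ← Real.rpow_natCast,
          show -(6 * θ) + 2 * (3 * θ - 2) = -((4 : ℕ) : ℝ) by push_cast; ring,
          Real.rpow_neg hl.le, ← Real.inv_rpow hl.le]
      rw [← hw, sub_zero, mul_pow, e, mul_assoc]
      gcongr ?_ * _
      exact Real.rpow_le_rpow_of_nonpos hN0 (not_le.1 hi).le (by linarith)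
  have hlow' : Summable fun i => lam i ^ 2 * sineCoeff y₀ i ^ 2 :=
    (hsum.mul_left _).of_nonneg_of_le (fun i => by positivity) hlow
  have hA : ∑' i, lam i ^ 2 * sineCoeff y₀ i ^ 2 ≤ N ^ (6 * (1 - θ)) * Z := by
    rw [hZ, ← tsum_mul_left]
    exact hlow'.tsum_le_tsum hlow (hsum.mul_left _)
  have hB : ‖G (x₀ - y₀)‖ ^ 2 ≤ N ^ (-(6 * θ)) * Z :=
    hasSum_le hhigh (hasSum_sineCoeff_sq _) (hsum.hasSum.mul_left _)
  have e1 := error_le_of_smooth hdt hT hM hr hS hY hYh hlow'.hasSum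
  have hWY := hW.sub hY
  have hWYh := hWh.sub hYh
  simp only [Pi.zero_apply, sub_zero] at hWY hWYh
  have e2 := error_le_of_rough hdt hT hM (isOrthProj_projCl (secondDerivs S)) hWY hWYh
  rw [← hc] at e1 e2
  have hc0 : 0 ≤ c := by positivity
  have hp1 : h ^ (2 * r) * N ^ (6 * (1 - θ)) = (h ^ (r * θ)) ^ 2 := by
    rw [hN, ← Real.rpow_natCast, ← Real.rpow_mul hP.le, ← Real.rpow_add hP, ← Real.rpow_natCast,
      ← Real.rpow_mul hP.le]
    congr 1
    push_cast
    ring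
  have hp2 : N ^ (-(6 * θ)) = (h ^ (r * θ)) ^ 2 := by
    rw [hN, ← Real.rpow_mul hP.le, ← Real.rpow_natCast, ← Real.rpow_mul hP.le]
    congr 1
    push_cast
    ring
  have f1 : c ^ 2 * (4 * h ^ (2 * r) * ∑' i, lam i ^ 2 * sineCoeff y₀ i ^ 2) ≤
      4 * c ^ 2 * ((h ^ (r * θ)) ^ 2 * Z) := by
    calc _ ≤ c ^ 2 * (4 * h ^ (2 * r) * (N ^ (6 * (1 - θ)) * Z)) := by gcongr
      _ = 4 * c ^ 2 * ((h ^ (2 * r) * N ^ (6 * (1 - θ))) * Z) := by ring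
      _ = _ := by rw [hp1]
  have f2 : 4 * c * ‖G (x₀ - y₀)‖ ^ 2 ≤ 4 * c * ((h ^ (r * θ)) ^ 2 * Z) := by
    rw [← hp2]
    gcongr
  have f3 : ∑ m ∈ Finset.Icc 1 M, ‖W m - Wh m‖ ^ 2 ≤
      2 * ∑ m ∈ Finset.Icc 1 M, ‖Y m - Yh m‖ ^ 2 +
        2 * ∑ m ∈ Finset.Icc 1 M, ‖W m - Y m - (Wh m - Yh m)‖ ^ 2 := by
    rw [Finset.mul_sum, Finset.mul_sum, ← Finset.sum_add_distrib]
    refine Finset.sum_le_sum fun m _ => ?_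
    have := norm_add_le (Y m - Yh m) (W m - Y m - (Wh m - Yh m))
    rw [show Y m - Yh m + (W m - Y m - (Wh m - Yh m)) = W m - Wh m by abel] at this
    nlinarith [sq_nonneg (‖Y m - Yh m‖ - ‖W m - Y m - (Wh m - Yh m)‖),
      norm_nonneg (W m - Wh m)]
  have f4 := mul_le_mul_of_nonneg_left f3 hdt.le
  calc _ ≤ _ := f4
    _ ≤ 2 * (4 * c ^ 2 * ((h ^ (r * θ)) ^ 2 * Z)) + 2 * (4 * c * ((h ^ (r * θ)) ^ 2 * Z)) := by
      linarith
    _ = _ := by ring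

end IMEX

end

/-- Error estimate for the fully discrete modified IMEX finite element approximations. -/
theorem mainTheorem4 (T : ℝ) (hT : 0 < T) (μ : ℝ) (r : ℕ) (hr : r = 2 ∨ r = 3) :
    ∃ C : ℝ, 0 < C ∧
      ∀ (M : ℕ) (_ : 1 ≤ M) (P : IMEX.Partition) (S : Submodule ℝ IMEX.L2D)
        (_ : IMEX.IsFESpace P r S)
        (w₀ : IMEX.L2D) (_ : w₀ ∈ IMEX.dotH 1)
        (W Wh : ℕ → IMEX.L2D)
        (_ : IMEX.IsTimeDiscrete μ (T / M) M w₀ W)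
        (_ : IMEX.IsFullyDiscrete μ (T / M) M S w₀ Wh)
        (θ : ℝ) (_ : 0 ≤ θ) (_ : θ ≤ 1),
        (T / M * ∑ m ∈ Finset.Icc 1 M, ‖W m - Wh m‖ ^ 2) ^ (1 / 2 : ℝ)
          ≤ C * P.meshSize ^ ((r : ℝ) * θ) * IMEX.dotNorm (3 * θ - 2) w₀ := by
  set c : ℝ := 8 * ((2 * Real.exp (2 * μ ^ 2 * T)) ^ 2 + 2 * Real.exp (2 * μ ^ 2 * T)) with hc
  have hc0 : 0 < c := by positivity
  refine ⟨√c, Real.sqrt_pos.2 hc0, ?_⟩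
  intro M hM P S hS w₀ hw₀ W Wh hW hWh θ hθ0 hθ1
  have hM0 : (0 : ℝ) < M := by exact_mod_cast hM
  have h := IMEX.error_sq_le (div_pos hT hM0) (div_mul_cancel₀ T hM0.ne') hM hr hS hw₀
    (hW.isScheme hM) (hWh.isScheme hS) hθ0 hθ1
  have hp : 0 ≤ P.meshSize ^ ((r : ℝ) * θ) := Real.rpow_nonneg P.meshSize_pos.le _
  rw [← Real.sqrt_eq_rpow, IMEX.dotNorm]
  refine (Real.sqrt_le_sqrt h).trans_eq ?_
  rw [Real.sqrt_mul (by positivity), Real.sqrt_mul hc0.le, Real.sqrt_sq hp]
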